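/- **Notation.** For $z=(x,\omega)\in\mathbb{R}^{2d}$ let $\pi(z)f(t)=e^{2\pi i\omega\cdot t}f(t-x)$, $Pf(t)=f(-t)$, and $\Omega(z,z')=x'\cdot\omega-x\cdot\omega'$. $M^1(\mathbb{R}^n)$ is Feichtinger's algebra (the functions whose short-time Fourier transform with Gaussian window is integrable), and $M^\infty(\mathbb{R}^n)$ is its space of continuous antilinear functionals. $\mathcal{M}^\infty=\mathcal{L}(M^1(\mathbb{R}^d),M^\infty(\mathbb{R}^d))$, and $\mathcal{M}^1$ is the set of operators $S\in\mathcal M^\infty$ with Weyl symbol $\sigma_S\in M^1(\mathbb{R}^{2d})$, i.e. $\langle Sf,g\rangle=\langle\sigma_S,W(g,f)\rangle$ for all $f,g\in M^1(\mathbb{R}^d)$, where $W(g,f)(x,\omega)=\int g(x+\tfrac t2)\overline{f(x-\tfrac t2)}e^{-2\pi i\omega\cdot t}\,dt$. For $T\in\mathcal{M}^\infty$ and $A\in\mathcal{M}^1$ with a nuclear representation $A=\sum_n f_n\otimes g_n$, where $(f_n\otimes g_n)h=\langle h,g_n\rangle f_n$ and $\sum_n\|f_n\|_{M^1}\|g_n\|_{M^1}<\infty$,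 put $\mathrm{tr}(TA)=\sum_n\langle Tf_n,g_n\rangle$; weak-$*$ convergence in $\mathcal{M}^\infty$ is with respect to the bracket $\langle T,R\rangle=\mathrm{tr}(TR^*)$, $R\in\mathcal{M}^1$. The convolution of $T\in\mathcal M^\infty$ and $S\in\mathcal M^1$ is $T\star S(z)=\mathrm{tr}\big(T\,\pi(z)PSP\pi(z)^*\big)$. Let $\Lambda\subset\mathbb{R}^{2d}$ be a full-rank lattice and $\Lambda^\circ=\{z: e^{2\pi i\Omega(z,\lambda)}=1\ \forall\lambda\in\Lambda\}$ its adjoint lattice. $T\in\mathcal{M}^\infty$ is called $\Lambda$-modulation invariant if $T=e^{-\pi i\lambda_1\cdot\lambda_2/2}\,\pi(\lambda/2)\,T\,\pi(\lambda/2)$ for every $\lambda=(\lambda_1,\lambda_2)\in\Lambda$. **Theorem (Sampled Convolutions).** Let $K\subset\mathbb{R}^{2d}$ be a compact neighbourhood of $0$ with $K\cap\Lambda^\circ=\{0\}$, and let $S\in\mathcal{M}^1$ satisfy $\sigma_S(0)\neq0$ and $\operatorname{supp}(\sigma_S)\subset K$. Then for every $\Lambda$-modulation invariant operator $T\in\mathcal{M}^\infty$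 the trace defining $T\star S(z)$ is well defined for every $z\in\mathbb{R}^{2d}$ (a nuclear representation exists and the value does not depend on it), and $$T=\frac{2^d}{\sigma_S(0)}\sum_{\lambda^\circ\in\Lambda^\circ}T\star S(\lambda^\circ)\,e^{-4\pi i\lambda^\circ_1\cdot\lambda^\circ_2}\,\pi(2\lambda^\circ)P,$$ where the series converges unconditionally in the weak-$*$ topology of $\mathcal{M}^\infty$. -/

import Mathlib

open MeasureTheory Filter Topology
open scoped ComplexConjugate

set_option linter.unusedSectionVars false

noncomputable section

namespace QHA

section TimeFrequency

variable {E : Type*} [NormedAddCommGroup E] [InnerProductSpace ℝ E] [FiniteDimensional ℝ E]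
  [MeasurableSpace E] [BorelSpace E]

/-- The character `θ ↦ e^{2πiθ}` of the real line. -/
def e (θ : ℝ) : ℂ := Complex.exp (2 * Real.pi * Complex.I * θ)

/-- The `L²`-normalised Gaussian `2^{n/4} e^{-π|t|²}` on an `n`-dimensional Euclidean space. -/
def gauss (t : E) : ℝ :=
  (2 : ℝ) ^ ((Module.finrank ℝ E : ℝ) / 4) * Real.exp (-Real.pi * ‖t‖ ^ 2)

/-- The short-time Fourier transform with Gaussian window `φ₀`,
`(x, ω) ↦ ⟨f, M_ω T_x φ₀⟩ = ∫ f(t) φ₀(t - x) e^{-2πi ω·t} dt`. -/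
def stft (f : E → ℂ) (z : E × E) : ℂ :=
  ∫ t, f t * (gauss (t - z.1) : ℂ) * e (-inner ℝ z.2 t)

theorem e_norm (θ : ℝ) : ‖e θ‖ = 1 := by
  have : (2 * Real.pi * Complex.I * θ : ℂ) = ((2 * Real.pi * θ : ℝ) : ℂ) * Complex.I := by
    push_cast; ring
  rw [e, this, Complex.norm_exp_ofReal_mul_I]

theorem e_add (a b : ℝ) : e (a + b) = e a * e b := by
  simp only [e, ← Complex.exp_add]
  congr 1
  push_cast
  ring

theorem e_continuous : Continuous e := by unfold e; fun_prop

theorem gauss_continuous : Continuous (gauss : E → ℝ) := by unfold gauss; fun_prop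

theorem gauss_pos (t : E) : 0 < gauss t := by unfold gauss; positivity

theorem gauss_neg (t : E) : gauss (-t) = gauss t := by simp [gauss]

theorem gauss_le (t : E) : gauss t ≤ gauss (0 : E) := by
  have h : 0 ≤ Real.pi * ‖t‖ ^ 2 := by positivity
  unfold gauss
  refine mul_le_mul_of_nonneg_left (Real.exp_le_exp.mpr ?_) (by positivity)
  rw [norm_zero, neg_mul]
  simpa using h

theorem gauss_integrable : Integrable (gauss : E → ℝ) := by
  have h := GaussianFourier.integrable_cexp_neg_mul_sq_norm_add (V := E) (b := (Real.pi : ℂ))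
    (by simpa using Real.pi_pos) 0 0
  have h2 := h.norm.const_mul ((2 : ℝ) ^ ((Module.finrank ℝ E : ℝ) / 4))
  refine h2.congr (ae_of_all _ fun t => ?_)
  simp [gauss, Complex.norm_exp, ← Complex.ofReal_pow]

theorem gauss_integral_pos : 0 < ∫ t : E, gauss t := by
  rw [integral_pos_iff_support_of_nonneg (fun t => (gauss_pos t).le) gauss_integrable]
  have : Function.support (gauss : E → ℝ) = Set.univ :=
    Set.eq_univ_of_forall fun t => (gauss_pos t).ne'
  rw [this]
  exact isOpen_univ.measure_pos _ Set.univ_nonempty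

theorem stft_integrand {f : E → ℂ} (hf : Integrable f) (z : E × E) :
    Integrable fun t => f t * (gauss (t - z.1) : ℂ) * e (-inner ℝ z.2 t) := by
  have h1 : Integrable fun t => f t * (gauss (t - z.1) : ℂ) := by
    refine hf.mul_bdd (c := gauss (0 : E)) ?_ (ae_of_all _ fun t => ?_)
    · exact (Complex.continuous_ofReal.comp
        (gauss_continuous.comp (continuous_id.sub continuous_const))).aestronglyMeasurable
    · rw [Complex.norm_real, Real.norm_of_nonneg (gauss_pos _).le]
      exact gauss_le _
  refine h1.mul_bdd (c := 1) ?_ (ae_of_all _ fun t => (e_norm _).le)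
  exact (e_continuous.comp (by fun_prop)).aestronglyMeasurable

/-- The functions of Feichtinger's algebra: continuous integrable functions whose short-time
Fourier transform is integrable over the time-frequency plane. (Every tempered distribution with
integrable short-time Fourier transform is given by such a function.) -/
def feichtinger (E : Type*) [NormedAddCommGroup E] [InnerProductSpace ℝ E]
    [FiniteDimensional ℝ E] [MeasurableSpace E] [BorelSpace E] : Submodule ℂ (E → ℂ) where
  carrier := {f | Continuous f ∧ Integrable f ∧ Integrable (stft f)}
  zero_mem' := by
    refine ⟨continuous_const, integrable_zero _ _ _, ?_⟩
    have : stft (0 : E → ℂ) = fun _ => 0 := by funext z; simp [stft]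
    rw [this]
    exact integrable_zero _ _ _
  add_mem' := by
    rintro f g ⟨hf, hf1, hf2⟩ ⟨hg, hg1, hg2⟩
    refine ⟨hf.add hg, hf1.add hg1, ?_⟩
    have : stft (f + g) = stft f + stft g := by
      funext z
      simp only [stft, Pi.add_apply, add_mul]
      exact integral_add (stft_integrand hf1 z) (stft_integrand hg1 z)
    rw [this]
    exact hf2.add hg2
  smul_mem' := by
    rintro c f ⟨hf, hf1, hf2⟩
    refine ⟨hf.const_smul c, hf1.smul c, ?_⟩
    have : stft (c • f) = c • stft f := by
      funext z
      simp only [stft, Pi.smul_apply, smul_eq_mul, mul_assoc]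
      exact integral_const_mul _ _
    rw [this]
    exact hf2.smul c

/-- Feichtinger's algebra `M¹(E)`, a normed space with the norm `‖f‖ = ‖V_{φ₀} f‖_{L¹}`. -/
def M1 (E : Type*) [NormedAddCommGroup E] [InnerProductSpace ℝ E]
    [FiniteDimensional ℝ E] [MeasurableSpace E] [BorelSpace E] : Type _ := ↥(feichtinger E)

instance : AddCommGroup (M1 E) := inferInstanceAs (AddCommGroup ↥(feichtinger E))

instance : Module ℂ (M1 E) := inferInstanceAs (Module ℂ ↥(feichtinger E))

instance : CoeFun (M1 E) (fun _ => E → ℂ) := ⟨fun f => f.1⟩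

namespace M1

theorem ext {f g : M1 E} (h : ∀ t, f t = g t) : f = g := Subtype.ext (funext h)

theorem add_apply (f g : M1 E) (t : E) : (f + g) t = f t + g t := rfl

theorem smul_apply (c : ℂ) (f : M1 E) (t : E) : (c • f) t = c * f t := rfl

theorem continuous (f : M1 E) : Continuous f := f.2.1

theorem integrable (f : M1 E) : Integrable f := f.2.2.1

theorem integrable_stft (f : M1 E) : Integrable (stft f) := f.2.2.2

theorem stft_add (f g : M1 E) (z : E × E) : stft (f + g) z = stft f z + stft g z := by
  simp only [stft, add_apply, add_mul]
  exact integral_add (stft_integrand f.integrable z) (stft_integrand g.integrable z)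

theorem stft_smul (c : ℂ) (f : M1 E) (z : E × E) : stft (c • f) z = c * stft f z := by
  simp only [stft, smul_apply, mul_assoc]
  exact integral_const_mul _ _

/-- By Fourier inversion, `|f(t)| φ₀(t - x) ≤ ∫ |V f(x, ω)| dω`. -/
theorem pointwise_bound (f : M1 E) :
    ∀ᵐ x : E, ∀ t : E, ‖f t‖ * gauss (t - x) ≤ ∫ w, ‖stft f (x, w)‖ := by
  have hint : Integrable (stft f) ((volume : Measure E).prod volume) := f.integrable_stft
  filter_upwards [hint.prod_right_ae] with x hx t
  set h : E → ℂ := fun t => f t * (gauss (t - x) : ℂ) with hh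
  have hc : Continuous h := f.continuous.mul
    (Complex.continuous_ofReal.comp (gauss_continuous.comp (continuous_id.sub continuous_const)))
  have hi : Integrable h := by
    have := stft_integrand f.integrable (x, (0 : E))
    simpa [e, hh] using this
  have hF : FourierTransform.fourier h = fun w => stft f (x, w) := by
    funext w
    rw [Real.fourier_eq', stft]
    refine integral_congr_ae (ae_of_all _ fun t => ?_)
    simp only [hh, smul_eq_mul, e, real_inner_comm]
    rw [mul_comm]
    congr 2
    push_cast
    ring
  have hinv := hc.fourierInv_fourier_eq hi (by rw [hF]; exact hx)
  have ht : h t = FourierTransformInv.fourierInv (FourierTransform.fourier h) t := by rw [hinv]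
  have hn : ‖h t‖ = ‖f t‖ * gauss (t - x) := by
    rw [hh, norm_mul, Complex.norm_real, Real.norm_of_nonneg (gauss_pos _).le]
  rw [← hn, ht, Real.fourierInv_eq', hF]
  refine (norm_integral_le_integral_norm _).trans (le_of_eq ?_)
  refine integral_congr_ae (ae_of_all _ fun w => ?_)
  simp only [norm_smul, Complex.norm_exp_ofReal_mul_I, one_mul]

theorem integrable_marginal (f : M1 E) : Integrable fun x : E => ∫ w, ‖stft f (x, w)‖ := by
  have hint : Integrable (stft f) ((volume : Measure E).prod volume) := f.integrable_stft
  exact hint.norm.integral_prod_left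

theorem integral_marginal (f : M1 E) :
    ∫ x : E, ∫ w, ‖stft f (x, w)‖ = ∫ z, ‖stft f z‖ := by
  have hint : Integrable (stft f) ((volume : Measure E).prod volume) := f.integrable_stft
  exact (integral_prod _ hint.norm).symm

theorem sup_bound (f : M1 E) (t : E) :
    ‖f t‖ * ∫ x : E, gauss x ≤ ∫ z, ‖stft f z‖ := by
  have h1 : ∫ x : E, ‖f t‖ * gauss (t - x) = ‖f t‖ * ∫ x : E, gauss x := by
    rw [integral_const_mul, integral_sub_left_eq_self (gauss : E → ℝ) volume t]
  rw [← h1, ← integral_marginal]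
  refine integral_mono_ae ?_ f.integrable_marginal ?_
  · exact ((gauss_integrable (E := E)).comp_sub_left t).const_mul _
  · filter_upwards [f.pointwise_bound] with x hx using hx t

instance : Norm (M1 E) := ⟨fun f => ∫ z, ‖stft f z‖⟩

theorem norm_def (f : M1 E) : ‖f‖ = ∫ z, ‖stft f z‖ := rfl

theorem norm_smul_eq (c : ℂ) (f : M1 E) : ‖c • f‖ = ‖c‖ * ‖f‖ := by
  simp only [norm_def, stft_smul, norm_mul]
  exact integral_const_mul _ _

/-- The norm `‖V_{φ₀} f‖_{L¹}` as a group norm. -/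
def groupNorm (E : Type*) [NormedAddCommGroup E] [InnerProductSpace ℝ E]
    [FiniteDimensional ℝ E] [MeasurableSpace E] [BorelSpace E] : AddGroupNorm (M1 E) where
  toFun f := ‖f‖
  map_zero' := by
    have := norm_smul_eq (0 : ℂ) (0 : M1 E)
    simpa using this
  add_le' f g := by
    simp only [norm_def, stft_add]
    rw [← integral_add f.integrable_stft.norm g.integrable_stft.norm]
    refine integral_mono (f.integrable_stft.add g.integrable_stft).norm
      (f.integrable_stft.norm.add g.integrable_stft.norm) fun z => norm_add_le _ _
  neg' f := by
    have := norm_smul_eq (-1 : ℂ) f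
    simpa using this
  eq_zero_of_map_eq_zero' f hf := by
    refine ext fun t => ?_
    have h := f.sup_bound t
    rw [← norm_def, hf] at h
    have := gauss_integral_pos (E := E)
    have h0 : ‖f t‖ ≤ 0 := by
      by_contra hc
      push Not at hc
      exact absurd h (not_le.mpr (mul_pos hc this))
    exact norm_le_zero_iff.mp h0

instance : NormedAddCommGroup (M1 E) where
  toAddCommGroup := inferInstance
  toMetricSpace := (groupNorm E).toNormedAddCommGroup.toMetricSpace
  toNorm := inferInstance
  dist_eq := (groupNorm E).toNormedAddCommGroup.dist_eq

instance : NormedSpace ℂ (M1 E) where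
  norm_smul_le c f := (norm_smul_eq c f).le


theorem norm_apply_le (f : M1 E) (t : E) : ‖f t‖ ≤ (∫ x : E, gauss x)⁻¹ * ‖f‖ := by
  have h := f.sup_bound t
  have hp := gauss_integral_pos (E := E)
  rw [← norm_def] at h
  rw [inv_mul_eq_div, le_div_iff₀ hp]
  exact h

theorem gauss_sq_integrable : Integrable fun t : E => gauss t * gauss t := by
  refine (gauss_integrable (E := E)).mul_bdd (c := gauss (0 : E))
    gauss_continuous.aestronglyMeasurable (ae_of_all _ fun t => ?_)
  rw [Real.norm_of_nonneg (gauss_pos _).le]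
  exact gauss_le _

theorem gauss_sq_integral_pos : 0 < ∫ t : E, gauss t * gauss t := by
  rw [integral_pos_iff_support_of_nonneg
    (fun t => (mul_pos (gauss_pos t) (gauss_pos t)).le) gauss_sq_integrable]
  have : Function.support (fun t : E => gauss t * gauss t) = Set.univ :=
    Set.eq_univ_of_forall fun t => (mul_pos (gauss_pos t) (gauss_pos t)).ne'
  rw [this]
  exact isOpen_univ.measure_pos _ Set.univ_nonempty

theorem integral_norm_le (f : M1 E) : ∫ t, ‖f t‖ ≤
    (∫ t : E, gauss t * gauss t)⁻¹ * ((∫ x : E, gauss x) * ‖f‖) := by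
  set G : E → ℝ := fun x => ∫ w, ‖stft f (x, w)‖ with hG
  have hp := gauss_sq_integral_pos (E := E)
  rw [inv_mul_eq_div, le_div_iff₀ hp, ← integral_mul_const]
  have hconv := (gauss_integrable (E := E)).integrable_convolution
    (ContinuousLinearMap.mul ℝ ℝ) f.integrable_marginal
  have hval := integral_convolution (ContinuousLinearMap.mul ℝ ℝ)
    (gauss_integrable (E := E)) f.integrable_marginal
  rw [integral_marginal] at hval
  rw [norm_def]
  change _ = (∫ x : E, gauss x) * _ at hval
  rw [← hval]
  have hfib := ((gauss_integrable (E := E)).convolution_integrand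
    (ContinuousLinearMap.mul ℝ ℝ) f.integrable_marginal).prod_right_ae
  refine integral_mono_ae (f.integrable.norm.mul_const _) hconv ?_
  filter_upwards [hfib] with t ht
  change ‖f t‖ * _ ≤ ∫ s, gauss s * G (t - s)
  rw [← integral_const_mul]
  refine integral_mono_ae (gauss_sq_integrable.const_mul _) ht ?_
  have hq : ∀ᵐ s : E, ∀ u : E, ‖f u‖ * gauss (u - (t - s)) ≤ G (t - s) :=
    (quasiMeasurePreserving_sub_left volume t).ae f.pointwise_bound
  filter_upwards [hq] with s hs
  have := hs t
  rw [sub_sub_cancel] at this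
  change ‖f t‖ * (gauss s * gauss s) ≤ gauss s * G (t - s)
  nlinarith [gauss_pos s]

theorem integrable_mul_conj (f g : M1 E) : Integrable fun t => f t * conj (g t) := by
  refine f.integrable.mul_bdd (c := (∫ x : E, gauss x)⁻¹ * ‖g‖)
    (Complex.continuous_conj.comp g.continuous).aestronglyMeasurable (ae_of_all _ fun t => ?_)
  rw [RCLike.norm_conj]
  exact g.norm_apply_le t

theorem integral_mul_conj_le (f g : M1 E) : ‖∫ t, f t * conj (g t)‖ ≤
    ((∫ t : E, gauss t * gauss t)⁻¹ * (∫ x : E, gauss x) * (∫ x : E, gauss x)⁻¹) *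
      ‖f‖ * ‖g‖ := by
  have hp := gauss_integral_pos (E := E)
  calc ‖∫ t, f t * conj (g t)‖ ≤ ∫ t, ‖f t * conj (g t)‖ := norm_integral_le_integral_norm _
    _ ≤ ∫ t, ‖f t‖ * ((∫ x : E, gauss x)⁻¹ * ‖g‖) := by
        refine integral_mono (integrable_mul_conj f g).norm (f.integrable.norm.mul_const _) ?_
        intro t
        simp only [norm_mul, RCLike.norm_conj]
        exact mul_le_mul_of_nonneg_left (g.norm_apply_le t) (norm_nonneg _)
    _ = (∫ t, ‖f t‖) * ((∫ x : E, gauss x)⁻¹ * ‖g‖) := integral_mul_const _ _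
    _ ≤ ((∫ t : E, gauss t * gauss t)⁻¹ * ((∫ x : E, gauss x) * ‖f‖)) *
          ((∫ x : E, gauss x)⁻¹ * ‖g‖) :=
        mul_le_mul_of_nonneg_right f.integral_norm_le (by positivity)
    _ = _ := by ring

end M1

/-- `M^∞(E)`: the continuous antilinear functionals on `M¹(E)`; `u g` is the bracket `⟨u, g⟩`. -/
abbrev MInf (E : Type*) [NormedAddCommGroup E] [InnerProductSpace ℝ E]
    [FiniteDimensional ℝ E] [MeasurableSpace E] [BorelSpace E] : Type _ := M1 E →L⋆[ℂ] ℂ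

/-- The operator space `𝓜^∞ = 𝓛(M¹(E), M^∞(E))`; `T f g` is the bracket `⟨T f, g⟩`. -/
abbrev OpMInf (E : Type*) [NormedAddCommGroup E] [InnerProductSpace ℝ E]
    [FiniteDimensional ℝ E] [MeasurableSpace E] [BorelSpace E] : Type _ := M1 E →L[ℂ] MInf E

/-- The phase space `E × Ê` of points `z = (x, ω) = (z.fst, z.snd)`, with its Euclidean
structure. -/
abbrev Phase (E : Type*) : Type _ := WithLp 2 (E × E)

/-- The embedding `M¹(E) → M^∞(E)`, `⟨f, g⟩ = ∫ f(t) conj(g(t)) dt`. As an element of `𝓜^∞`, it is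
the identity operator. -/
def embed : M1 E →L[ℂ] MInf E :=
  LinearMap.mkContinuousOfExistsBound₂
    (LinearMap.mk₂'ₛₗ (RingHom.id ℂ) (starRingEnd ℂ)
      (fun f g : M1 E => ∫ t, f t * conj (g t))
      (fun f f' g => by
        simp only [M1.add_apply, add_mul]
        exact integral_add (M1.integrable_mul_conj f g) (M1.integrable_mul_conj f' g))
      (fun c f g => by
        simp only [M1.smul_apply, mul_assoc]
        exact integral_const_mul _ _)
      (fun f g g' => by
        simp only [M1.add_apply, map_add, mul_add]
        exact integral_add (M1.integrable_mul_conj f g) (M1.integrable_mul_conj f g'))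
      (fun c f g => by
        simp only [M1.smul_apply, map_mul, mul_left_comm (_ : ℂ) (conj c)]
        exact integral_const_mul _ _))
    ⟨_, fun f g => M1.integral_mul_conj_le f g⟩

theorem embed_apply (f g : M1 E) : embed f g = ∫ t, f t * conj (g t) := rfl

/-- The function `M_ω T_x f`, `t ↦ e^{2πi ω·t} f(t - x)`. -/
def shiftFun (z : Phase E) (f : E → ℂ) (t : E) : ℂ := e (inner ℝ z.snd t) * f (t - z.fst)

theorem stft_shiftFun (z : Phase E) (f : E → ℂ) (w : E × E) :
    stft (shiftFun z f) w =
      e (inner ℝ (z.snd - w.2) z.fst) * stft f (w - (z.fst, z.snd)) := by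
  rw [stft, stft, ← integral_const_mul,
    ← integral_add_right_eq_self (μ := (volume : Measure E)) _ z.fst]
  refine integral_congr_ae (ae_of_all _ fun t => ?_)
  have h1 : t + z.fst - w.1 = t - (w.1 - z.fst) := by abel
  simp only [shiftFun, Prod.fst_sub, Prod.snd_sub, add_sub_cancel_right, h1]
  have h2 : e (inner ℝ z.snd (t + z.fst)) * e (-inner ℝ w.2 (t + z.fst)) =
      e (inner ℝ (z.snd - w.2) z.fst) * e (-inner ℝ (w.2 - z.snd) t) := by
    rw [← e_add, ← e_add]
    congr 1
    simp only [inner_add_right, inner_sub_left]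
    ring
  linear_combination (f t * (gauss (t - (w.1 - z.fst)) : ℂ)) * h2

theorem stft_neg (f : E → ℂ) (w : E × E) : stft (fun t => f (-t)) w = stft f (-w) := by
  rw [stft, stft, ← integral_neg_eq_self]
  refine integral_congr_ae (ae_of_all _ fun t => ?_)
  have h : gauss (-t - w.1) = gauss (t + w.1) := by rw [← gauss_neg]; congr 1; abel
  simp only [neg_neg, Prod.fst_neg, Prod.snd_neg, sub_neg_eq_add, h, inner_neg_right,
    inner_neg_left]

theorem norm_stft_shiftFun (z : Phase E) (f : E → ℂ) (w : E × E) :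
    ‖stft (shiftFun z f) w‖ = ‖stft f (w - (z.fst, z.snd))‖ := by
  rw [stft_shiftFun, norm_mul, e_norm, one_mul]

instance : (volume : Measure (E × E)).IsAddHaarMeasure :=
  inferInstanceAs ((volume : Measure E).prod volume).IsAddHaarMeasure

/-- The time-frequency shift `π(z) = M_ω T_x` on `M¹(E)`, for `z = (x, ω)`. -/
def tfShift (z : Phase E) : M1 E →L[ℂ] M1 E :=
  LinearMap.mkContinuous
    { toFun := fun f => ⟨shiftFun z f, by
        refine ⟨?_, ?_, ?_⟩
        · exact (e_continuous.comp (by fun_prop)).mul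
            (f.continuous.comp (continuous_id.sub continuous_const))
        · refine (f.integrable.comp_sub_right z.fst).bdd_mul (c := 1)
            (e_continuous.comp (by fun_prop)).aestronglyMeasurable
            (ae_of_all _ fun t => (e_norm _).le)
        · have h : stft (shiftFun z f) = fun w =>
              e (inner ℝ (z.snd - w.2) z.fst) * stft f (w - (z.fst, z.snd)) :=
            funext (stft_shiftFun z f)
          rw [h]
          refine (f.integrable_stft.comp_sub_right (z.fst, z.snd)).bdd_mul (c := 1)
            (e_continuous.comp (by fun_prop)).aestronglyMeasurable
            (ae_of_all _ fun t => (e_norm _).le)⟩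
      map_add' := fun f g => M1.ext fun t => mul_add _ _ _
      map_smul' := fun c f => M1.ext fun t => mul_left_comm _ _ _ }
    1 (fun f => by
      rw [one_mul]
      refine le_of_eq ?_
      change ∫ w, ‖stft (shiftFun z f) w‖ = ∫ w, ‖stft f w‖
      simp only [norm_stft_shiftFun]
      exact integral_sub_right_eq_self (fun w => ‖stft f w‖) (z.fst, z.snd))

theorem tfShift_apply (z : Phase E) (f : M1 E) (t : E) :
    tfShift z f t = e (inner ℝ z.snd t) * f (t - z.fst) := rfl

/-- The adjoint `π(z)^* = e^{-2πi x·ω} π(-z)`. -/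
def tfShiftAdj (z : Phase E) : M1 E →L[ℂ] M1 E := e (-inner ℝ z.fst z.snd) • tfShift (-z)

/-- The parity operator `(P f)(t) = f(-t)` on `M¹(E)`; it is its own adjoint. -/
def parity : M1 E →L[ℂ] M1 E :=
  LinearMap.mkContinuous
    { toFun := fun f => ⟨fun t => f (-t), by
        refine ⟨f.continuous.comp continuous_neg, f.integrable.comp_neg, ?_⟩
        have h : stft (fun t => f (-t)) = fun w => stft f (-w) := funext (stft_neg f)
        rw [h]
        exact f.integrable_stft.comp_neg⟩
      map_add' := fun f g => M1.ext fun t => rfl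
      map_smul' := fun c f => M1.ext fun t => rfl }
    1 (fun f => by
      rw [one_mul]
      refine le_of_eq ?_
      change ∫ w, ‖stft (fun t => f (-t)) w‖ = ∫ w, ‖stft f w‖
      simp only [stft_neg]
      exact integral_neg_eq_self (fun w => ‖stft f w‖) volume)

theorem parity_apply (f : M1 E) (t : E) : parity f t = f (-t) := rfl

theorem embed_tfShift (z : Phase E) (f g : M1 E) :
    embed (tfShift z f) g = embed f (tfShiftAdj z g) := by
  rw [embed_apply, embed_apply,
    ← integral_add_right_eq_self (μ := (volume : Measure E)) _ z.fst]
  refine integral_congr_ae (ae_of_all _ fun t => ?_)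
  have hc : ∀ θ : ℝ, conj (e θ) = e (-θ) := fun θ => by
    rw [e, e, ← Complex.exp_conj]
    congr 1
    simp only [map_mul, Complex.conj_I, Complex.conj_ofReal, map_ofNat]
    push_cast
    ring
  change e (inner ℝ z.snd (t + z.fst)) * f (t + z.fst - z.fst) * conj (g (t + z.fst)) =
    f t * conj (e (-inner ℝ z.fst z.snd) * (e (inner ℝ (-z).snd t) * g (t - (-z).fst)))
  have h1 : (-z).snd = -z.snd := rfl
  have h2 : (-z).fst = -z.fst := rfl
  rw [h1, h2, add_sub_cancel_right, sub_neg_eq_add, map_mul, map_mul, hc, hc, neg_neg,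
    inner_neg_left, neg_neg, inner_add_right, e_add, real_inner_comm z.fst z.snd]
  ring

theorem embed_parity (f g : M1 E) : embed (parity f) g = embed f (parity g) := by
  rw [embed_apply, embed_apply, ← integral_neg_eq_self]
  refine integral_congr_ae (ae_of_all _ fun t => ?_)
  simp only [parity_apply, neg_neg]

end TimeFrequency

section Operators

variable {E : Type*} [NormedAddCommGroup E] [InnerProductSpace ℝ E] [FiniteDimensional ℝ E]
  [MeasurableSpace E] [BorelSpace E]

/-- For bounded operators `A` and `B` on `M¹(E)`, the element of `𝓜^∞` given by
`⟨B' T A f, g⟩ = ⟨T (A f), B g⟩`, where `B'` is the operator on `M^∞(E)` dual to `B`: if `B` is the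
restriction to `M¹(E)` of an adjoint `C^*`, then `B'` extends `C`. -/
def sandwich (B A : M1 E →L[ℂ] M1 E) (T : OpMInf E) : OpMInf E :=
  LinearMap.mkContinuousOfExistsBound₂
    (LinearMap.mk₂'ₛₗ (RingHom.id ℂ) (starRingEnd ℂ) (fun f g : M1 E => T (A f) (B g))
      (fun f f' g => by simp) (fun c f g => by simp)
      (fun f g g' => by simp) (fun c f g => by simp))
    ⟨‖T‖ * ‖A‖ * ‖B‖, fun f g => by
      calc ‖T (A f) (B g)‖ ≤ ‖T‖ * ‖A f‖ * ‖B g‖ := T.le_opNorm₂ _ _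
        _ ≤ ‖T‖ * (‖A‖ * ‖f‖) * (‖B‖ * ‖g‖) := by
            gcongr
            · exact A.le_opNorm f
            · exact B.le_opNorm g
        _ = ‖T‖ * ‖A‖ * ‖B‖ * ‖f‖ * ‖g‖ := by ring⟩

theorem sandwich_apply (B A : M1 E →L[ℂ] M1 E) (T : OpMInf E) (f g : M1 E) :
    sandwich B A T f g = T (A f) (B g) := rfl

/-- The adjoint of an operator: `⟨R^* f, g⟩ = conj ⟨R g, f⟩`. -/
def opAdjoint (R : OpMInf E) : OpMInf E :=
  LinearMap.mkContinuousOfExistsBound₂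
    (LinearMap.mk₂'ₛₗ (RingHom.id ℂ) (starRingEnd ℂ) (fun f g : M1 E => conj (R g f))
      (fun f f' g => by simp) (fun c f g => by simp)
      (fun f g g' => by simp) (fun c f g => by simp))
    ⟨‖R‖, fun f g => by
      change ‖conj (R g f)‖ ≤ _
      rw [RCLike.norm_conj]
      exact (R.le_opNorm₂ _ _).trans (le_of_eq (by ring))⟩

theorem opAdjoint_apply (R : OpMInf E) (f g : M1 E) : opAdjoint R f g = conj (R g f) := rfl

/-- Operator translation `α_z(T) = π(z) T π(z)^*`. -/
def opTranslate (z : Phase E) (T : OpMInf E) : OpMInf E :=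
  sandwich (tfShiftAdj z) (tfShiftAdj z) T

/-- Operator modulation `β_w(T) = e^{-πi w₁·w₂/2} π(w/2) T π(w/2)`. -/
def opModulate (w : Phase E) (T : OpMInf E) : OpMInf E :=
  Complex.exp (-Real.pi * Complex.I * (inner ℝ w.fst w.snd : ℝ) / 2) •
    sandwich (tfShiftAdj ((1 / 2 : ℝ) • w)) (tfShift ((1 / 2 : ℝ) • w)) T

/-- `Š = P S P`. -/
def opCheck (S : OpMInf E) : OpMInf E := sandwich parity parity S

/-- The cross-Wigner distribution
`W(f, g)(x, ω) = ∫ f(x + t/2) conj(g(x - t/2)) e^{-2πi ω·t} dt`. -/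
def wigner (f g : E → ℂ) (z : Phase E) : ℂ :=
  ∫ t, f (z.fst + (1 / 2 : ℝ) • t) * conj (g (z.fst - (1 / 2 : ℝ) • t)) * e (-inner ℝ z.snd t)

/-- The function `σ ∈ M¹` on phase space is the Weyl symbol of `S`:
`⟨S f, g⟩ = ⟨σ, W(g, f)⟩ = ∫ σ(z) conj(W(g, f)(z)) dz`. -/
def IsWeylSymbol (S : OpMInf E) (σ : M1 (Phase E)) : Prop :=
  ∀ f g : M1 E, S f g = ∫ z, σ z * conj (wigner g f z)

/-- `S ∈ 𝓜¹`: the operator `S` has a Weyl symbol in `M¹`. -/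
def IsM1Op (S : OpMInf E) : Prop := ∃ σ : M1 (Phase E), IsWeylSymbol S σ

/-- `A = ∑ₙ fₙ ⊗ gₙ` is a nuclear representation, where `(f ⊗ g) h = ⟨h, g⟩ f`, with
`∑ₙ ‖fₙ‖ ‖gₙ‖ < ∞` in the norm of `M¹(E)`. -/
def IsNuclearRep (A : OpMInf E) (f g : ℕ → M1 E) : Prop :=
  Summable (fun n => ‖f n‖ * ‖g n‖) ∧
    ∀ h k : M1 E, HasSum (fun n => embed h (g n) * embed (f n) k) (A h k)

/-- `t` is the trace of the composition `T A = ∑ₙ (T fₙ) ⊗ gₙ`, i.e. `t = ∑ₙ ⟨T fₙ, gₙ⟩`, for some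
nuclear representation `A = ∑ₙ fₙ ⊗ gₙ`. -/
def IsTraceMul (T A : OpMInf E) (t : ℂ) : Prop :=
  ∃ f g : ℕ → M1 E, IsNuclearRep A f g ∧ HasSum (fun n => T (f n) (g n)) t

open Classical in
/-- The trace `tr(T A)`, for `T ∈ 𝓜^∞` and `A ∈ 𝓜¹`. -/
def traceMul (T A : OpMInf E) : ℂ := if h : ∃ t, IsTraceMul T A t then h.choose else 0

/-- The convolution of two operators, `(T ⋆ S)(z) = tr(T α_z(Š))`. -/
def opConv (T S : OpMInf E) (z : Phase E) : ℂ := traceMul T (opTranslate z (opCheck S))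

/-- The duality bracket `⟨T, R⟩ = tr(T R^*)` of `T ∈ 𝓜^∞` and `R ∈ 𝓜¹`. -/
def bracket (T R : OpMInf E) : ℂ := traceMul T (opAdjoint R)

/-- `∑ᵢ uᵢ = T` unconditionally in the weak-* topology of `𝓜^∞`, the dual of `𝓜¹`. -/
def WeakStarHasSum {ι : Type*} (u : ι → OpMInf E) (T : OpMInf E) : Prop :=
  ∀ R : OpMInf E, IsM1Op R → HasSum (fun i => bracket (u i) R) (bracket T R)

/-- The symplectic form `Ω(z, z') = x'·ω - x·ω'`. -/
def symp (z z' : Phase E) : ℝ := inner ℝ z'.fst z.snd - inner ℝ z.fst z'.snd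

/-- The adjoint lattice `Λ° = {z : e^{2πi Ω(z, λ)} = 1 for all λ ∈ Λ}`. -/
def adjointLattice (Λ : Submodule ℤ (Phase E)) : Set (Phase E) :=
  {z | ∀ l ∈ Λ, e (symp z l) = 1}

/-- `T = β_λ(T)` for every `λ ∈ Λ`. -/
def IsModulationInvariant (Λ : Submodule ℤ (Phase E)) (T : OpMInf E) : Prop :=
  ∀ l ∈ Λ, opModulate l T = T

/-- The operator `π(z) P`, as an element of `𝓜^∞`. -/
def shiftParity (z : Phase E) : OpMInf E := embed.comp ((tfShift z).comp parity)

end Operators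

end QHA

end

open QHA

/-! Formally, the Weyl symbol of a `Λ`-modulation invariant operator `T` is a sum of point masses `∑
c_z δ_z` over `z ∈ Λ°`. Since `tr(TA)` pairs the symbols of `T` and `A`, the proof amounts to
`tr(TA) = ∑ c_z τ(z)` for every `A` with symbol `τ ∈ M¹`, with `c` depending only on `T`
(`exists_sampling_coefficients`). Two choices of `A` then finish it. The operator `π(z)PSPπ(z)^*`
has symbol `u ↦ σ(z - u)`, which is supported in `z - K` and so sees only the point `z` of `Λ°`;
hence `T ⋆ S(z) = c_z σ(0)`. On the other side, `2^d e^{-4πi z₁·z₂} π(2z)P` is the Weyl quantisation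
of `δ_z` (Grossmann and Royer), so the series, paired with `R`, is `∑ c_z conj(ρ(z))`, where `ρ` is
the symbol of `R`. This is `tr(TR^*)`.

No symbol of `T` as a distribution is used. Everything is expressed by matrix elements in the
coherent states `π(z)φ₀`. The reproducing formula `integral_smul_atom` turns the trace of any
nuclear representation into `∫ kern A p.swap * kern T p` (`hasSum_trace`), which shows that the
trace is well defined; integrability of `kern A` in turn gives a nuclear representation
(`exists_isNuclearRep`).

In coordinates `(m, v)` of midpoint and difference, the matrix elements of `A` are, up to a phase,
the short-time Fourier transform of `τ` with window `φ₀²` (`kern_midpoint_swap`), because the Wigner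
distribution of two coherent states is a modulated `φ₀²` centred at `m`. Modulation invariance of
`T` becomes `Λ`-periodicity of its kernel in `v` (`weylKern_add`). Integrating over `v` against a
periodic function samples the Fourier transform on the dual lattice (`integral_mul_periodic`), here
the windowed symbol `τ φ₀(· - m)²` on `Λ°`. Integrating over `m` gives the coefficients `c_z`;
samples of an `M¹` function on `Λ°` are summable, so the interchange is absolute and convergence
unconditional. -/

noncomputable section

namespace QHA

/-! ### Sums of integrable functions with summable `L¹` norms. -/

section SumIntegral

variable {α ι F : Type*} [MeasurableSpace α] {μ : Measure α} [Countable ι] [NormedAddCommGroup F]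

theorem lintegral_tsum_enorm_ne_top {f : ι → α → F} (hf : ∀ i, Integrable (f i) μ)
    (hs : Summable fun i => ∫ a, ‖f i a‖ ∂μ) : ∫⁻ a, ∑' i, ‖f i a‖ₑ ∂μ ≠ ⊤ := by
  rw [lintegral_tsum fun i => (hf i).1.enorm]
  have h : ∀ i, ∫⁻ a, ‖f i a‖ₑ ∂μ = ENNReal.ofReal (∫ a, ‖f i a‖ ∂μ) := fun i =>
    (ofReal_integral_norm_eq_lintegral_enorm (hf i)).symm
  simp only [h]
  rw [← ENNReal.ofReal_tsum_of_nonneg (fun i => integral_nonneg fun a => norm_nonneg _) hs]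
  exact ENNReal.ofReal_ne_top

theorem ae_summable_norm {f : ι → α → F} (hf : ∀ i, Integrable (f i) μ)
    (hs : Summable fun i => ∫ a, ‖f i a‖ ∂μ) : ∀ᵐ a ∂μ, Summable fun i => ‖f i a‖ := by
  have hm : AEMeasurable (fun a => ∑' i, ‖f i a‖ₑ) μ :=
    AEMeasurable.tsum fun i => (hf i).1.enorm
  filter_upwards [ae_lt_top' hm (lintegral_tsum_enorm_ne_top hf hs)] with a ha
  have := ENNReal.summable_toReal ha.ne
  simpa using this

theorem integrable_tsum_norm {f : ι → α → F} (hf : ∀ i, Integrable (f i) μ)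
    (hs : Summable fun i => ∫ a, ‖f i a‖ ∂μ) : Integrable (fun a => ∑' i, ‖f i a‖) μ := by
  have hm : AEMeasurable (fun a => ∑' i, ‖f i a‖ₑ) μ :=
    AEMeasurable.tsum fun i => (hf i).1.enorm
  refine (integrable_toReal_of_lintegral_ne_top hm (lintegral_tsum_enorm_ne_top hf hs)).congr ?_
  refine ae_of_all _ fun a => ?_
  change (∑' i, ‖f i a‖ₑ).toReal = _
  rw [ENNReal.tsum_toReal_eq fun i => enorm_ne_top]
  simp

end SumIntegral

/-! ### Gaussian integrals and coherent states. -/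

section Gaussian

variable {E : Type*} [NormedAddCommGroup E] [InnerProductSpace ℝ E] [FiniteDimensional ℝ E]
  [MeasurableSpace E] [BorelSpace E]

theorem e_zero : e 0 = 1 := by simp [e]

theorem e_mul_e_neg (θ : ℝ) : e θ * e (-θ) = 1 := by rw [← e_add, add_neg_cancel, e_zero]

theorem conj_e (θ : ℝ) : conj (e θ) = e (-θ) := by
  rw [e, e, ← Complex.exp_conj]
  congr 1
  simp only [map_mul, Complex.conj_I, Complex.conj_ofReal, map_ofNat]
  push_cast
  ring

theorem fourier_eq_integral_e (f : E → ℂ) (w : E) :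
    FourierTransform.fourier f w = ∫ t, f t * e (-inner ℝ w t) := by
  rw [Real.fourier_eq']
  refine integral_congr_ae (ae_of_all _ fun t => ?_)
  simp only [smul_eq_mul, e, real_inner_comm]
  rw [mul_comm]
  congr 2
  push_cast
  ring

theorem fourierInv_eq_integral_e (f : E → ℂ) (w : E) :
    FourierTransformInv.fourierInv f w = ∫ t, f t * e (inner ℝ w t) := by
  rw [Real.fourierInv_eq']
  refine integral_congr_ae (ae_of_all _ fun t => ?_)
  simp only [smul_eq_mul, e, real_inner_comm]
  rw [mul_comm]
  congr 2
  push_cast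
  ring

theorem integral_exp_mul_e {b : ℝ} (hb : 0 < b) (w : E) :
    ∫ t : E, ((Real.exp (-b * ‖t‖ ^ 2) : ℝ) : ℂ) * e (-inner ℝ w t) =
      (((Real.pi / b) ^ ((Module.finrank ℝ E : ℝ) / 2) *
        Real.exp (-Real.pi ^ 2 * ‖w‖ ^ 2 / b) : ℝ) : ℂ) := by
  have h := fourier_gaussian_innerProductSpace (V := E) (b := (b : ℂ)) (by simpa using hb) w
  rw [fourier_eq_integral_e] at h
  have h2 : ∀ t : E, ((Real.exp (-b * ‖t‖ ^ 2) : ℝ) : ℂ) = Complex.exp (-(b : ℂ) * (‖t‖ : ℂ) ^ 2) :=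
    fun t => by push_cast; rfl
  simp only [h2]
  rw [h]
  rw [Complex.ofReal_mul, Complex.ofReal_cpow (by positivity)]
  push_cast
  rfl

theorem integrable_exp_neg_norm_sq {b : ℝ} (hb : 0 < b) :
    Integrable fun t : E => Real.exp (-b * ‖t‖ ^ 2) := by
  have h := GaussianFourier.integrable_cexp_neg_mul_sq_norm_add (V := E) (b := (b : ℂ))
    (by simpa using hb) 0 0
  refine h.norm.congr (ae_of_all _ fun t => ?_)
  simp [Complex.norm_exp, ← Complex.ofReal_pow]

theorem gauss_add_mul_gauss_sub (y s : E) : gauss (y + s) * gauss (y - s) =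
    (2 : ℝ) ^ ((Module.finrank ℝ E : ℝ) / 2) * Real.exp (-(2 * Real.pi) * ‖y‖ ^ 2) *
      Real.exp (-(2 * Real.pi) * ‖s‖ ^ 2) := by
  have h : ‖y + s‖ ^ 2 + ‖y - s‖ ^ 2 = 2 * (‖y‖ ^ 2 + ‖s‖ ^ 2) := by
    have := parallelogram_law_with_norm ℝ y s
    nlinarith
  have h2 : ((2 : ℝ) ^ ((Module.finrank ℝ E : ℝ) / 2)) =
      (2 : ℝ) ^ ((Module.finrank ℝ E : ℝ) / 4) * (2 : ℝ) ^ ((Module.finrank ℝ E : ℝ) / 4) := by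
    rw [← Real.rpow_add (by norm_num)]; congr 1; ring
  rw [gauss, gauss, h2, mul_mul_mul_comm, ← Real.exp_add, mul_assoc (_ * _) (Real.exp _),
    ← Real.exp_add]
  congr 2
  linear_combination (-Real.pi) * h

/-- The Gaussian as a complex valued function. -/
def gaussC (t : E) : ℂ := (gauss t : ℂ)

theorem gaussC_continuous : Continuous (gaussC : E → ℂ) :=
  Complex.continuous_ofReal.comp gauss_continuous

theorem gaussC_integrable : Integrable (gaussC : E → ℂ) := gauss_integrable.ofReal

theorem two_rpow_mul_half_rpow (s : ℝ) : (2 : ℝ) ^ s * (Real.pi / (2 * Real.pi)) ^ s = 1 := by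
  rw [← Real.mul_rpow (by norm_num) (by positivity)]
  have : 2 * (Real.pi / (2 * Real.pi)) = 1 := by field_simp
  rw [this, Real.one_rpow]

/-- Moving the origin to `w.1 / 2` makes the two Gaussians symmetric, so `gauss_add_mul_gauss_sub`
pulls out the dependence on `w.1` and leaves the Fourier transform of a single Gaussian. -/
theorem stft_gaussC (w : E × E) : stft (gaussC : E → ℂ) w =
    e (-inner ℝ w.2 ((1 / 2 : ℝ) • w.1)) *
      ((Real.exp (-(Real.pi / 2) * ‖w.1‖ ^ 2) * Real.exp (-(Real.pi / 2) * ‖w.2‖ ^ 2) : ℝ) : ℂ) := by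
  rw [stft, ← integral_add_right_eq_self (μ := (volume : Measure E)) _ ((1 / 2 : ℝ) • w.1)]
  have h : ∀ t : E, gaussC (t + (1 / 2 : ℝ) • w.1) * (gauss (t + (1 / 2 : ℝ) • w.1 - w.1) : ℂ) *
      e (-inner ℝ w.2 (t + (1 / 2 : ℝ) • w.1)) =
      (e (-inner ℝ w.2 ((1 / 2 : ℝ) • w.1)) *
        (((2 : ℝ) ^ ((Module.finrank ℝ E : ℝ) / 2) *
          Real.exp (-(2 * Real.pi) * ‖(1 / 2 : ℝ) • w.1‖ ^ 2) : ℝ) : ℂ)) *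
      (((Real.exp (-(2 * Real.pi) * ‖t‖ ^ 2) : ℝ) : ℂ) * e (-inner ℝ w.2 t)) := by
    intro t
    have h1 : t + (1 / 2 : ℝ) • w.1 - w.1 = t - (1 / 2 : ℝ) • w.1 := by module
    rw [h1, gaussC, ← Complex.ofReal_mul, gauss_add_mul_gauss_sub, inner_add_right, neg_add, e_add]
    push_cast
    ring
  simp only [h]
  rw [integral_const_mul, integral_exp_mul_e (by positivity), mul_assoc, ← Complex.ofReal_mul]
  congr 2
  rw [mul_mul_mul_comm, two_rpow_mul_half_rpow, one_mul]
  congr 2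
  · rw [norm_smul]; norm_num; ring
  · have := Real.pi_pos.ne'; field_simp

theorem norm_stft_gaussC (w : E × E) : ‖stft (gaussC : E → ℂ) w‖ =
    Real.exp (-(Real.pi / 2) * ‖w.1‖ ^ 2) * Real.exp (-(Real.pi / 2) * ‖w.2‖ ^ 2) := by
  rw [stft_gaussC, norm_mul, e_norm, one_mul, Complex.norm_real, Real.norm_of_nonneg (by positivity)]

theorem continuous_stft_gaussC : Continuous (stft (gaussC : E → ℂ)) := by
  have h : stft (gaussC : E → ℂ) = _ := funext stft_gaussC
  rw [h]
  refine (e_continuous.comp (by fun_prop)).mul (Complex.continuous_ofReal.comp (by fun_prop))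

/-- The Gaussian window as an element of `M¹(E)`. -/
def gaussM1 : M1 E := ⟨gaussC, gaussC_continuous, gaussC_integrable, by
  have h : Integrable (fun w : E × E => Real.exp (-(Real.pi / 2) * ‖w.1‖ ^ 2) *
      Real.exp (-(Real.pi / 2) * ‖w.2‖ ^ 2)) :=
    (integrable_exp_neg_norm_sq (by positivity)).mul_prod
      (integrable_exp_neg_norm_sq (by positivity))
  refine h.mono' continuous_stft_gaussC.aestronglyMeasurable (ae_of_all _ fun w => ?_)
  exact (norm_stft_gaussC w).le⟩

/-- The time-frequency shifted Gaussian `π(z) φ₀`. -/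
def atom (z : Phase E) : M1 E := tfShift z gaussM1

theorem atom_apply (z : Phase E) (t : E) :
    atom z t = e (inner ℝ z.snd t) * (gauss (t - z.fst) : ℂ) := rfl

theorem embed_atom (f : M1 E) (z : Phase E) : embed f (atom z) = stft f (z.fst, z.snd) := by
  rw [embed_apply, stft]
  refine integral_congr_ae (ae_of_all _ fun t => ?_)
  simp only [atom_apply, map_mul, conj_e, Complex.conj_ofReal]
  ring

theorem embed_conj_symm (f g : M1 E) : conj (embed f g) = embed g f := by
  rw [embed_apply, embed_apply, ← integral_conj]
  refine integral_congr_ae (ae_of_all _ fun t => ?_)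
  simp only [map_mul, Complex.conj_conj]
  ring

theorem norm_tfShift (z : Phase E) (f : M1 E) : ‖tfShift z f‖ = ‖f‖ := by
  change ∫ w, ‖stft (shiftFun z f) w‖ = ∫ w, ‖stft f w‖
  simp only [norm_stft_shiftFun]
  exact integral_sub_right_eq_self (fun w => ‖stft f w‖) (z.fst, z.snd)

theorem norm_atom (z : Phase E) : ‖atom z‖ = ‖(gaussM1 : M1 E)‖ := norm_tfShift z _

theorem tfShift_tfShift (a b : Phase E) (f : M1 E) :
    tfShift a (tfShift b f) = e (-inner ℝ b.snd a.fst) • tfShift (a + b) f := by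
  refine M1.ext fun t => ?_
  simp only [tfShift_apply, M1.smul_apply]
  have h1 : (a + b).snd = a.snd + b.snd := rfl
  have h2 : (a + b).fst = a.fst + b.fst := rfl
  rw [h1, h2, inner_add_left, inner_sub_right, e_add, sub_eq_add_neg, e_add,
    sub_add_eq_sub_sub]
  ring

theorem tfShift_atom (a b : Phase E) :
    tfShift a (atom b) = e (-inner ℝ b.snd a.fst) • atom (a + b) := tfShift_tfShift a b _

/-- Halving the exponent absorbs the shift, since `‖x‖² ≤ 2 (‖x - y‖² + r²)`. The bound is uniform
in `‖y‖ ≤ r`, which makes it a dominating function for nearby coherent states. -/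
theorem exp_neg_norm_sub_sq_le {a : ℝ} (ha : 0 < a) (x y : E) {r : ℝ} (hy : ‖y‖ ≤ r) :
    Real.exp (-a * ‖x - y‖ ^ 2) ≤ Real.exp (a * r ^ 2) * Real.exp (-(a / 2) * ‖x‖ ^ 2) := by
  rw [← Real.exp_add]
  refine Real.exp_le_exp.mpr ?_
  have h1 : ‖x‖ ≤ ‖x - y‖ + ‖y‖ := by
    simpa using norm_add_le (x - y) y
  have h2 : ‖x‖ ^ 2 ≤ 2 * (‖x - y‖ ^ 2 + r ^ 2) := by
    have h3 : ‖x‖ ≤ ‖x - y‖ + r := by linarith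
    nlinarith [norm_nonneg x, norm_nonneg (x - y), norm_nonneg y, sq_nonneg (‖x - y‖ - r)]
  nlinarith

theorem stft_atom (z : Phase E) (w : E × E) : stft (atom z) w =
    e (inner ℝ (z.snd - w.2) z.fst) * stft (gaussC : E → ℂ) (w - (z.fst, z.snd)) :=
  stft_shiftFun z gaussC w

theorem norm_stft_atom_le (z : Phase E) (w : E × E) {r : ℝ} (hz : ‖z‖ ≤ r) : ‖stft (atom z) w‖ ≤
    (Real.exp (Real.pi / 2 * r ^ 2) * Real.exp (-(Real.pi / 2 / 2) * ‖w.1‖ ^ 2)) *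
      (Real.exp (Real.pi / 2 * r ^ 2) * Real.exp (-(Real.pi / 2 / 2) * ‖w.2‖ ^ 2)) := by
  rw [stft_atom, norm_mul, e_norm, one_mul, norm_stft_gaussC]
  have hp : 0 < Real.pi / 2 := by positivity
  exact mul_le_mul
    (exp_neg_norm_sub_sq_le hp _ _ ((WithLp.norm_fst_le _ z).trans hz))
    (exp_neg_norm_sub_sq_le hp _ _ ((WithLp.norm_snd_le _ z).trans hz))
    (by positivity) (by positivity)

theorem stft_eq_embed (f : M1 E) (w : E × E) : stft f w = embed f (atom (WithLp.toLp 2 w)) :=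
  (embed_atom f (WithLp.toLp 2 w)).symm

theorem stft_sub (f g : M1 E) (w : E × E) : stft (f - g : M1 E) w = stft f w - stft g w := by
  simp only [stft_eq_embed, map_sub, _root_.sub_apply]

/-- Dominated convergence: near `z₀` the short-time Fourier transforms of all atoms lie below one
Gaussian, and they depend continuously on `z` pointwise. Norm continuity supplies the measurability
needed for Bochner integrals of atoms. -/
theorem continuous_atom : Continuous (atom : Phase E → M1 E) := by
  rw [continuous_iff_continuousAt]
  intro z₀
  rw [ContinuousAt, tendsto_iff_norm_sub_tendsto_zero]
  set r : ℝ := ‖z₀‖ + 1 with hr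
  set B : E × E → ℝ := fun w =>
    (Real.exp (Real.pi / 2 * r ^ 2) * Real.exp (-(Real.pi / 2 / 2) * ‖w.1‖ ^ 2)) *
      (Real.exp (Real.pi / 2 * r ^ 2) * Real.exp (-(Real.pi / 2 / 2) * ‖w.2‖ ^ 2)) with hB
  have hBi : Integrable B :=
    ((integrable_exp_neg_norm_sq (by positivity)).const_mul _).mul_prod
      ((integrable_exp_neg_norm_sq (by positivity)).const_mul _)
  have h0 : ∫ w : E × E, ‖stft (atom z₀ - atom z₀ : M1 E) w‖ = 0 := by
    rw [← M1.norm_def, sub_self, norm_zero]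
  simp only [M1.norm_def]
  rw [← h0]
  refine tendsto_integral_filter_of_dominated_convergence (fun w => B w + B w) ?_ ?_
    (hBi.add hBi) ?_
  · exact Eventually.of_forall fun z => (M1.integrable_stft _).norm.1
  · have : ∀ᶠ z in 𝓝 z₀, ‖z‖ ≤ r := by
      have h1 : ∀ᶠ z in 𝓝 z₀, ‖z‖ < r :=
        continuous_norm.continuousAt.eventually_lt continuousAt_const (by rw [hr]; linarith)
      filter_upwards [h1] with z hz using hz.le
    filter_upwards [this] with z hz
    refine ae_of_all _ fun w => ?_
    rw [norm_norm, stft_sub]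
    refine (norm_sub_le _ _).trans (add_le_add (norm_stft_atom_le z w hz)
      (norm_stft_atom_le z₀ w (by rw [hr]; linarith)))
  · refine ae_of_all _ fun w => ?_
    have hc : Continuous fun z : Phase E => ‖stft (atom z - atom z₀ : M1 E) w‖ := by
      simp only [stft_sub, stft_atom]
      refine (((e_continuous.comp (by fun_prop)).mul
        (continuous_stft_gaussC.comp (by fun_prop))).sub continuous_const).norm
    exact hc.tendsto z₀

end Gaussian

/-! ### Completeness of Feichtinger's algebra. -/

section Complete

variable {E : Type*} [NormedAddCommGroup E] [InnerProductSpace ℝ E] [FiniteDimensional ℝ E]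
  [MeasurableSpace E] [BorelSpace E]

/-- Evaluation at a point, as a continuous functional on `M¹(E)`. -/
def evalM1 (t : E) : M1 E →L[ℂ] ℂ :=
  LinearMap.mkContinuous
    { toFun := fun f => f t
      map_add' := fun f g => M1.add_apply f g t
      map_smul' := fun c f => M1.smul_apply c f t }
    (∫ x : E, gauss x)⁻¹ fun f => f.norm_apply_le t

theorem evalM1_apply (t : E) (f : M1 E) : evalM1 t f = f t := rfl

theorem sum_apply {ι : Type*} (s : Finset ι) (f : ι → M1 E) (t : E) :
    (∑ i ∈ s, f i) t = ∑ i ∈ s, f i t := by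
  simp only [← evalM1_apply, map_sum]

theorem stft_sum {ι : Type*} (s : Finset ι) (f : ι → M1 E) (w : E × E) :
    stft (∑ i ∈ s, f i : M1 E) w = ∑ i ∈ s, stft (f i) w := by
  simp only [stft_eq_embed, map_sum, _root_.sum_apply]

theorem integral_norm_le_const (f : M1 E) : ∫ t, ‖f t‖ ≤
    ((∫ t : E, gauss t * gauss t)⁻¹ * (∫ x : E, gauss x)) * ‖f‖ :=
  (f.integral_norm_le).trans (le_of_eq (by ring))

/-- The sup and `L¹` bounds by the `M¹` norm give an absolutely convergent series a continuous
integrable limit `F`. The short-time Fourier transforms sum pointwise to that of `F`, and domination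
by `∑ ‖V fₙ‖` upgrades this to norm convergence. Bochner integrals with values in `M¹` rely on this.
-/
instance : CompleteSpace (M1 E) := by
  refine NormedAddCommGroup.completeSpace_of_summable_imp_tendsto fun f hf => ?_
  have hsum1 : ∀ t, Summable fun n => ‖f n t‖ := fun t =>
    (hf.mul_left _).of_nonneg_of_le (fun n => norm_nonneg _) fun n => (f n).norm_apply_le t
  have hL1 : Summable fun n => ∫ t, ‖f n t‖ :=
    (hf.mul_left _).of_nonneg_of_le (fun n => integral_nonneg fun t => norm_nonneg _)
      fun n => integral_norm_le_const (f n)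
  have hint : Integrable fun t => ∑' n, ‖f n t‖ :=
    integrable_tsum_norm (fun n => (f n).integrable) hL1
  set F : E → ℂ := fun t => ∑' n, f n t with hF
  have hFc : Continuous F := continuous_tsum (fun n => (f n).continuous)
    (hf.mul_left (∫ x : E, gauss x)⁻¹) fun n t => (f n).norm_apply_le t
  have hFi : Integrable F := hint.mono' hFc.aestronglyMeasurable
    (ae_of_all _ fun t => norm_tsum_le_tsum_norm (hsum1 t))
  have hst : ∀ w, HasSum (fun n => stft (f n) w) (stft F w) := by
    intro w
    have hn : ∀ n t, ‖f n t * (gauss (t - w.1) : ℂ) * e (-inner ℝ w.2 t)‖ ≤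
        ‖f n t‖ * gauss (0 : E) := fun n t => by
      rw [norm_mul, e_norm, mul_one, norm_mul, Complex.norm_real,
        Real.norm_of_nonneg (gauss_pos _).le]
      exact mul_le_mul_of_nonneg_left (gauss_le _) (norm_nonneg _)
    have h := hasSum_integral_of_summable_integral_norm
      (F := fun n t => f n t * (gauss (t - w.1) : ℂ) * e (-inner ℝ w.2 t)) (μ := volume)
      (fun n => stft_integrand (f n).integrable w)
      ((hL1.mul_right (gauss (0 : E))).of_nonneg_of_le
        (fun n => integral_nonneg fun t => norm_nonneg _) fun n => by
          rw [← integral_mul_const]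
          exact integral_mono (stft_integrand (f n).integrable w).norm
            ((f n).integrable.norm.mul_const _) (hn n))
    simp only [tsum_mul_right] at h
    exact h
  have hst2 : Summable fun n => ∫ w, ‖stft (f n) w‖ := hf
  have hG := integrable_tsum_norm (fun n => (f n).integrable_stft) hst2
  have hGs := ae_summable_norm (fun n => (f n).integrable_stft) hst2
  have hFst : Integrable (stft F) := by
    refine hG.mono' ?_ ?_
    · refine aestronglyMeasurable_of_tendsto_ae atTop
        (f := fun N w => ∑ n ∈ Finset.range N, stft (f n) w) (fun N => ?_)
        (ae_of_all _ fun w => (hst w).tendsto_sum_nat)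
      exact (integrable_finsetSum _ fun n _ => (f n).integrable_stft).1
    · filter_upwards [hGs] with w hw
      rw [← (hst w).tsum_eq]
      exact norm_tsum_le_tsum_norm hw
  refine ⟨⟨F, hFc, hFi, hFst⟩, ?_⟩
  set a : M1 E := ⟨F, hFc, hFi, hFst⟩ with ha
  rw [tendsto_iff_norm_sub_tendsto_zero]
  have h0 : ∫ w : E × E, (0 : ℝ) = 0 := integral_zero _ _
  simp only [M1.norm_def]
  rw [← h0]
  refine tendsto_integral_filter_of_dominated_convergence
    (fun w => (∑' n, ‖stft (f n) w‖) + ∑' n, ‖stft (f n) w‖) ?_ ?_ (hG.add hG) ?_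
  · exact Eventually.of_forall fun N => (M1.integrable_stft _).norm.1
  · refine Eventually.of_forall fun N => ?_
    filter_upwards [hGs] with w hw
    rw [norm_norm, stft_sub, stft_sum]
    refine (norm_sub_le _ _).trans (add_le_add ?_ ?_)
    · exact (norm_sum_le _ _).trans (hw.sum_le_tsum _ fun n _ => norm_nonneg _)
    · change ‖stft F w‖ ≤ _
      rw [← (hst w).tsum_eq]
      exact norm_tsum_le_tsum_norm hw
  · refine ae_of_all _ fun w => ?_
    simp only [stft_sub, stft_sum]
    have := ((hst w).tendsto_sum_nat.sub_const (stft F w)).norm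
    rw [sub_self, norm_zero] at this
    exact this

end Complete

/-! ### Bochner integrable functions as absolutely summable step series. -/

section SimpleDecomposition

variable {α X : Type*} [MeasurableSpace α] {μ : Measure α} [NormedAddCommGroup X]
  [NormedSpace ℝ X]

theorem SimpleFunc.integral_norm_eq_sum (v : SimpleFunc α X) (hv : Integrable v μ) :
    ∫ x, ‖v x‖ ∂μ = ∑ y ∈ v.range, ‖y‖ * μ.real (v ⁻¹' {y}) := by
  have h := SimpleFunc.map_integral v (fun y => ‖y‖) hv norm_zero
  have h2 : Integrable (v.map fun y => ‖y‖) μ := hv.norm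
  rw [SimpleFunc.integral_eq_integral _ h2] at h
  refine Eq.trans ?_ (h.trans ?_)
  · rfl
  · exact Finset.sum_congr rfl fun y _ => by rw [smul_eq_mul, mul_comm]

theorem SimpleFunc.integral_mul_clm_eq_sum [NormedSpace ℂ X] (v : SimpleFunc α X)
    (hv : Integrable v μ) (ℓ : X →L[ℂ] ℂ) {h : α → ℂ} (hm : AEStronglyMeasurable h μ) {C : ℝ}
    (hC : ∀ x, ‖h x‖ ≤ C) :
    ∫ x, ℓ (v x) * h x ∂μ = ∑ y ∈ v.range, ℓ y * ∫ x in v ⁻¹' {y}, h x ∂μ := by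
  have h1 : ∀ x, ℓ (v x) * h x =
      ∑ y ∈ v.range, (v ⁻¹' {y}).indicator (fun x => ℓ y * h x) x := by
    intro x
    rw [Finset.sum_eq_single (v x)]
    · rw [Set.indicator_of_mem (show x ∈ v ⁻¹' {v x} from rfl)]
    · intro y _ hy
      exact Set.indicator_of_notMem (fun hx => hy hx.symm) _
    · intro hx
      exact absurd (SimpleFunc.mem_range_self v x) hx
  simp only [h1]
  rw [integral_finsetSum]
  · refine Finset.sum_congr rfl fun y _ => ?_
    rw [integral_indicator (v.measurableSet_fiber y), integral_const_mul]
  · intro y _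
    rw [integrable_indicator_iff (v.measurableSet_fiber y)]
    by_cases hy : y = 0
    · simp only [hy, map_zero, zero_mul]
      exact integrable_zero _ _ _
    · have hfin := SimpleFunc.measure_preimage_lt_top_of_integrable v hv hy
      exact (IntegrableOn.of_bound hfin hm.restrict C (ae_of_all _ hC)).const_mul _

/-- A concrete form of the identification of `L¹(μ; X)` with the projective tensor product of
`L¹(μ)` and `X`: telescope simple approximations with error `2⁻ⁿ` and split each difference into its
fibres. The conclusion is phrased after pairing with `ℓ` and a bounded `h`, the form in which
rank-one expansions are read off. -/
theorem exists_simple_decomposition [NormedSpace ℂ X] {f : α → X} (hf : Integrable f μ) :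
    ∃ (ι : Type) (_ : Countable ι) (a : ι → X) (s : ι → Set α),
      (∀ i, MeasurableSet (s i)) ∧ (∀ i, a i = 0 ∨ μ (s i) < ⊤) ∧
      Summable (fun i => ‖a i‖ * μ.real (s i)) ∧
      ∀ (ℓ : X →L[ℂ] ℂ) (h : α → ℂ), AEStronglyMeasurable h μ → ∀ C : ℝ, 0 ≤ C → (∀ x, ‖h x‖ ≤ C) →
        HasSum (fun i => ℓ (a i) * ∫ x in s i, h x ∂μ) (∫ x, ℓ (f x) * h x ∂μ) := by
  have hap : ∀ n : ℕ, ∃ g : SimpleFunc α X, Integrable g μ ∧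
      ∫ x, ‖f x - g x‖ ∂μ ≤ (1 / 2 : ℝ) ^ n := by
    intro n
    obtain ⟨g, hg, hgm⟩ := (memLp_one_iff_integrable.2 hf).exists_simpleFunc_eLpNorm_sub_lt
      ENNReal.one_ne_top (ε := ENNReal.ofReal ((1 / 2 : ℝ) ^ n)) (by simp)
    have hgi := memLp_one_iff_integrable.1 hgm
    refine ⟨g, hgi, ?_⟩
    rw [eLpNorm_one_eq_lintegral_enorm] at hg
    have h := ofReal_integral_norm_eq_lintegral_enorm (hf.sub hgi)
    rw [← h] at hg
    exact ((ENNReal.ofReal_lt_ofReal_iff (by positivity)).1 hg).le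
  choose g hgi hg using hap
  -- The differences telescope to `g N`. The zeroth entry is `g 0` itself, hence the ranges up to `N
  -- + 1` below.
  set v : ℕ → SimpleFunc α X := fun n => Nat.casesOn n (g 0) fun m => g (m + 1) - g m with hv
  have hv0 : v 0 = g 0 := rfl
  have hvs : ∀ m, v (m + 1) = g (m + 1) - g m := fun m => rfl
  have hvi : ∀ n, Integrable (v n) μ := by
    intro n
    cases n with
    | zero => exact hgi 0
    | succ m => exact (hgi (m + 1)).sub (hgi m)
  have hvn : ∀ m, ∫ x, ‖v (m + 1) x‖ ∂μ ≤ 2 * (1 / 2 : ℝ) ^ m := by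
    intro m
    have h1 : ∫ x, ‖v (m + 1) x‖ ∂μ ≤ ∫ x, (‖f x - g (m + 1) x‖ + ‖f x - g m x‖) ∂μ := by
      refine integral_mono (hvi (m + 1)).norm
        ((hf.sub (hgi (m + 1))).norm.add (hf.sub (hgi m)).norm) fun x => ?_
      have : v (m + 1) x = (f x - g m x) - (f x - g (m + 1) x) := by
        rw [hvs, SimpleFunc.coe_sub, Pi.sub_apply]; abel
      change ‖v (m + 1) x‖ ≤ ‖f x - g (m + 1) x‖ + ‖f x - g m x‖
      rw [this]
      exact (norm_sub_le _ _).trans (add_comm _ _).le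
    have h0 : ∫ x, (‖f x - g (m + 1) x‖ + ‖f x - g m x‖) ∂μ =
        (∫ x, ‖f x - g (m + 1) x‖ ∂μ) + ∫ x, ‖f x - g m x‖ ∂μ :=
      integral_add (hf.sub (hgi (m + 1))).norm (hf.sub (hgi m)).norm
    rw [h0] at h1
    have h2 := hg (m + 1)
    have h3 := hg m
    have h4 : (1 / 2 : ℝ) ^ (m + 1) ≤ (1 / 2 : ℝ) ^ m :=
      pow_le_pow_of_le_one (by norm_num) (by norm_num) (Nat.le_succ m)
    linarith
  have hvsum : Summable fun n => ∫ x, ‖v n x‖ ∂μ := by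
    rw [← summable_nat_add_iff 1]
    exact ((summable_geometric_of_lt_one (by norm_num) (by norm_num)).mul_left 2).of_nonneg_of_le
      (fun m => integral_nonneg fun x => norm_nonneg _) hvn
  have hpart : ∀ N x, ∑ n ∈ Finset.range (N + 1), v n x = g N x := by
    intro N x
    induction N with
    | zero => simp [hv0]
    | succ N ih =>
      rw [Finset.sum_range_succ, ih, hvs, SimpleFunc.coe_sub, Pi.sub_apply]; abel
  let e : ∀ n : ℕ, Fin (v n).range.card ≃ (v n).range := fun n => (v n).range.equivFin.symm
  have hsum : Summable (fun i : (Σ n, Fin (v n).range.card) =>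
      ‖((e i.1 i.2 : X))‖ * μ.real (v i.1 ⁻¹' {(e i.1 i.2 : X)})) := by
    rw [summable_sigma_of_nonneg fun i => by positivity]
    refine ⟨fun n => (hasSum_fintype _).summable, ?_⟩
    refine hvsum.congr fun n => ?_
    rw [tsum_fintype, SimpleFunc.integral_norm_eq_sum _ (hvi n), ← Finset.sum_coe_sort,
      ← (e n).sum_comp]
  refine ⟨(Σ n, Fin (v n).range.card), inferInstance, fun i => (e i.1 i.2 : X),
    fun i => v i.1 ⁻¹' {(e i.1 i.2 : X)}, fun i => (v i.1).measurableSet_fiber _, fun i => ?_,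
    hsum, ?_⟩
  -- Only the fibre over the value zero can have infinite measure.
  · by_cases h : (e i.1 i.2 : X) = 0
    · exact Or.inl h
    · exact Or.inr (SimpleFunc.measure_preimage_lt_top_of_integrable _ (hvi i.1) h)
  intro ℓ h hm C hC0 hC
  have hinner : ∀ n, ∑ j : Fin (v n).range.card,
      ℓ (e n j : X) * ∫ x in v n ⁻¹' {(e n j : X)}, h x ∂μ = ∫ x, ℓ (v n x) * h x ∂μ := by
    intro n
    rw [SimpleFunc.integral_mul_clm_eq_sum _ (hvi n) ℓ hm hC, ← Finset.sum_coe_sort (v n).range]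
    exact (e n).sum_comp fun y => ℓ (y : X) * ∫ x in v n ⁻¹' {(y : X)}, h x ∂μ
  have hS : Summable (fun i : (Σ n, Fin (v n).range.card) =>
      ℓ (e i.1 i.2 : X) * ∫ x in v i.1 ⁻¹' {(e i.1 i.2 : X)}, h x ∂μ) := by
    refine (hsum.mul_left (‖ℓ‖ * C)).of_norm_bounded fun i => ?_
    rw [norm_mul]
    by_cases h0 : (e i.1 i.2 : X) = 0
    · simp [h0]
    · have hfin := SimpleFunc.measure_preimage_lt_top_of_integrable _ (hvi i.1) h0
      have h1 : ‖∫ x in v i.1 ⁻¹' {(e i.1 i.2 : X)}, h x ∂μ‖ ≤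
          C * μ.real (v i.1 ⁻¹' {(e i.1 i.2 : X)}) :=
        norm_setIntegral_le_of_norm_le_const hfin fun x _ => hC x
      calc _ ≤ (‖ℓ‖ * ‖(e i.1 i.2 : X)‖) * (C * μ.real (v i.1 ⁻¹' {(e i.1 i.2 : X)})) :=
            mul_le_mul (ℓ.le_opNorm _) h1 (norm_nonneg _) (by positivity)
        _ = _ := by ring
  have hsig := hS.hasSum.sigma fun n => hasSum_fintype _
  simp only [hinner] at hsig
  have hlim : Tendsto (fun N => ∑ n ∈ Finset.range (N + 1), ∫ x, ℓ (v n x) * h x ∂μ) atTop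
      (𝓝 (∫ x, ℓ (f x) * h x ∂μ)) := by
    have hint : ∀ {F : α → X}, Integrable F μ → Integrable (fun x => ℓ (F x) * h x) μ :=
      fun hF => (ℓ.integrable_comp hF).mul_bdd (c := C) hm (ae_of_all _ hC)
    have h1 : ∀ N, ∑ n ∈ Finset.range (N + 1), ∫ x, ℓ (v n x) * h x ∂μ =
        ∫ x, ℓ (g N x) * h x ∂μ := by
      intro N
      rw [← integral_finsetSum _ fun n _ => hint (hvi n)]
      refine integral_congr_ae (ae_of_all _ fun x => ?_)
      change ∑ n ∈ Finset.range (N + 1), ℓ (v n x) * h x = _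
      rw [← Finset.sum_mul, ← map_sum, hpart]
    simp only [h1]
    rw [tendsto_iff_norm_sub_tendsto_zero]
    refine squeeze_zero (g := fun N : ℕ => (‖ℓ‖ * C) * (1 / 2 : ℝ) ^ N) (fun N => norm_nonneg _)
      (fun N => ?_) ?_
    · rw [← integral_sub (hint (hgi N)) (hint hf)]
      have h2 : ∀ x, ‖ℓ (g N x) * h x - ℓ (f x) * h x‖ ≤ (‖ℓ‖ * C) * ‖f x - g N x‖ := fun x => by
        rw [← sub_mul, ← map_sub, norm_mul, norm_sub_rev (f x)]
        calc _ ≤ (‖ℓ‖ * ‖g N x - f x‖) * C :=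
              mul_le_mul (ℓ.le_opNorm _) (hC x) (norm_nonneg _) (by positivity)
          _ = _ := by ring
      refine (norm_integral_le_integral_norm _).trans ?_
      refine (integral_mono ((hint (hgi N)).sub (hint hf)).norm
        ((hf.sub (hgi N)).norm.const_mul _) h2).trans ?_
      rw [integral_const_mul]
      exact mul_le_mul_of_nonneg_left (hg N) (mul_nonneg (norm_nonneg _) hC0)
    · have := (tendsto_pow_atTop_nhds_zero_of_lt_one (r := (1 / 2 : ℝ)) (by norm_num)
        (by norm_num)).const_mul (‖ℓ‖ * C)
      rwa [mul_zero] at this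
  have hu := tendsto_nhds_unique ((tendsto_add_atTop_iff_nat 1).2 hsig.tendsto_sum_nat) hlim
  rw [← hu]
  exact hS.hasSum

end SimpleDecomposition

/-! ### Coherent state expansions, traces and nuclear representations. -/

section Kernel

variable {E : Type*} [NormedAddCommGroup E] [InnerProductSpace ℝ E] [FiniteDimensional ℝ E]
  [MeasurableSpace E] [BorelSpace E]

theorem integrable_phase_iff {F : Type*} [NormedAddCommGroup F] {f : E × E → F} :
    Integrable (fun z : Phase E => f (z.fst, z.snd)) ↔ Integrable f :=
  (WithLp.volume_preserving_ofLp E E).integrable_comp_emb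
    (MeasurableEquiv.toLp 2 (E × E)).symm.measurableEmbedding

theorem integral_phase {F : Type*} [NormedAddCommGroup F] [NormedSpace ℝ F] (f : E × E → F) :
    ∫ z : Phase E, f (z.fst, z.snd) = ∫ w, f w :=
  (WithLp.volume_preserving_ofLp E E).integral_comp
    (MeasurableEquiv.toLp 2 (E × E)).symm.measurableEmbedding f

theorem integrable_embed_atom (f : M1 E) : Integrable fun z : Phase E => embed f (atom z) := by
  simp only [embed_atom]
  exact integrable_phase_iff.2 f.integrable_stft

theorem integral_norm_embed_atom (f : M1 E) : ∫ z : Phase E, ‖embed f (atom z)‖ = ‖f‖ := by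
  simp only [embed_atom]
  exact integral_phase fun w => ‖stft f w‖

theorem integral_gauss_sq : ∫ t : E, gauss t * gauss t = 1 := by
  have h : ∀ t : E, ((gauss t * gauss t : ℝ) : ℂ) =
      (((2 : ℝ) ^ ((Module.finrank ℝ E : ℝ) / 2) : ℝ) : ℂ) *
        (((Real.exp (-(2 * Real.pi) * ‖t‖ ^ 2) : ℝ) : ℂ) * e (-inner ℝ (0 : E) t)) := fun t => by
    have := gauss_add_mul_gauss_sub t (0 : E)
    rw [add_zero, sub_zero] at this
    rw [this, inner_zero_left, neg_zero, e_zero]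
    simp
  have h2 : ((∫ t : E, gauss t * gauss t : ℝ) : ℂ) = 1 := by
    rw [← integral_complex_ofReal]
    simp only [h]
    rw [integral_const_mul, integral_exp_mul_e (by positivity), ← Complex.ofReal_mul]
    rw [← mul_assoc, two_rpow_mul_half_rpow]
    simp
  exact_mod_cast h2

theorem window_inversion {F : E → ℂ} (hc : Continuous F) (hi : Integrable F) {x : E}
    (hx : Integrable fun w => stft F (x, w)) (t : E) :
    ∫ w, stft F (x, w) * e (inner ℝ w t) = F t * (gauss (t - x) : ℂ) := by
  set h : E → ℂ := fun t => F t * (gauss (t - x) : ℂ) with hh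
  have hc : Continuous h := hc.mul
    (Complex.continuous_ofReal.comp (gauss_continuous.comp (continuous_id.sub continuous_const)))
  have hi : Integrable h := by
    have := stft_integrand hi (x, (0 : E))
    simpa [e, hh] using this
  have hF : FourierTransform.fourier h = fun w => stft F (x, w) :=
    funext fun w => fourier_eq_integral_e h w
  have hinv := hc.fourierInv_fourier_eq hi (by rw [hF]; exact hx)
  rw [hF] at hinv
  have := congrFun hinv t
  rw [fourierInv_eq_integral_e] at this
  simp only [real_inner_comm t] at this ⊢
  exact this

theorem continuous_embed_atom (f : M1 E) : Continuous fun z : Phase E => embed f (atom z) :=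
  (embed f).continuous.comp continuous_atom

theorem norm_embed_atom_le (f : M1 E) (z : Phase E) :
    ‖embed f (atom z)‖ ≤ ‖embed f‖ * ‖(gaussM1 : M1 E)‖ := by
  rw [← norm_atom z]
  exact (embed f).le_opNorm _

theorem integrable_smul_atom {c : Phase E → ℂ} (hc : Integrable c) :
    Integrable fun z => c z • atom z := by
  refine (hc.norm.mul_const ‖(gaussM1 : M1 E)‖).mono'
    (hc.1.smul continuous_atom.aestronglyMeasurable) (ae_of_all _ fun z => ?_)
  rw [norm_smul, norm_atom]

/-- Point evaluations are continuous on `M¹`, so the identity may be tested at each `t`. Inverting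
the Fourier transform in the frequency variable leaves `f t` times the integral of `φ₀(t - x)²` over
`x`, which is 1. -/
theorem integral_smul_atom (f : M1 E) : ∫ z, embed f (atom z) • atom z = f := by
  have hI := integrable_smul_atom (integrable_embed_atom f)
  refine M1.ext fun t => ?_
  rw [← evalM1_apply, ← (evalM1 t).integral_comp_comm hI]
  have hs := f.integrable_stft
  have h1 : ∀ z : Phase E, evalM1 t (embed f (atom z) • atom z) =
      (fun w : E × E => stft f w * e (inner ℝ w.2 t) * (gauss (t - w.1) : ℂ)) (z.fst, z.snd) :=
    fun z => by
      rw [evalM1_apply, M1.smul_apply, atom_apply, embed_atom]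
      ring
  simp only [h1]
  rw [integral_phase fun w : E × E => stft f w * e (inner ℝ w.2 t) * (gauss (t - w.1) : ℂ)]
  have h2 : Integrable (fun w : E × E => stft f w * e (inner ℝ w.2 t) * (gauss (t - w.1) : ℂ)) := by
    refine (hs.mul_bdd (c := 1) (e_continuous.comp (by fun_prop)).aestronglyMeasurable
      (ae_of_all _ fun w => (e_norm _).le)).mul_bdd (c := gauss (0 : E))
      (Complex.continuous_ofReal.comp (gauss_continuous.comp
        (by fun_prop))).aestronglyMeasurable (ae_of_all _ fun w => ?_)
    rw [Complex.norm_real, Real.norm_of_nonneg (gauss_pos _).le]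
    exact gauss_le _
  rw [Measure.volume_eq_prod] at h2 ⊢
  rw [integral_prod _ h2]
  rw [Measure.volume_eq_prod] at hs
  have h3 : ∀ᵐ x : E, ∫ w : E, stft f (x, w) * e (inner ℝ w t) * (gauss (t - x) : ℂ) =
      f t * ((gauss (t - x) * gauss (t - x) : ℝ) : ℂ) := by
    filter_upwards [hs.prod_right_ae] with x hx
    rw [integral_mul_const, window_inversion f.continuous f.integrable hx, Complex.ofReal_mul,
      mul_assoc]
  rw [integral_congr_ae h3, integral_const_mul, integral_complex_ofReal,
    integral_sub_left_eq_self (fun x : E => gauss x * gauss x) volume t, integral_gauss_sq]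
  simp

/-- Elements of `M^∞` are antilinear; composing with conjugation reduces to the linear case, and
conjugation commutes with the integral. -/
theorem MInf_integral_comp_comm {α : Type*} [MeasurableSpace α] {μ : Measure α} (u : MInf E)
    {F : α → M1 E} (hF : Integrable F μ) : ∫ x, u (F x) ∂μ = u (∫ x, F x ∂μ) := by
  let L : M1 E →L[ℂ] ℂ := ((starL ℂ : ℂ ≃L⋆[ℂ] ℂ) : ℂ →L⋆[ℂ] ℂ).comp u
  have hL : ∀ g, L g = conj (u g) := fun g => rfl
  have h := L.integral_comp_comm hF
  simp only [hL] at h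
  rw [integral_conj] at h
  exact (starRingEnd ℂ).injective h

/-- The matrix `⟨A π(w) φ₀, π(z) φ₀⟩` of an operator in the time-frequency shifted Gaussians. -/
def kern (A : OpMInf E) (p : Phase E × Phase E) : ℂ := A (atom p.1) (atom p.2)

theorem continuous_kern (A : OpMInf E) : Continuous (kern A) := by
  have h : IsBoundedBilinearMap ℝ fun q : M1 E × M1 E => A q.1 q.2 :=
    { add_left := fun x y z => by simp
      smul_left := fun c x y => by
        rw [← Complex.coe_smul, ← Complex.coe_smul, map_smul]; rfl
      add_right := fun x y z => by simp
      smul_right := fun c x y => by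
        rw [← Complex.coe_smul, ← Complex.coe_smul, map_smulₛₗ, Complex.conj_ofReal]
      bound := ⟨‖A‖ + 1, by positivity, fun x y => (A.le_opNorm₂ x y).trans (by
        gcongr; linarith)⟩ }
  exact h.continuous.comp ((continuous_atom.comp continuous_fst).prodMk
    (continuous_atom.comp continuous_snd))

theorem norm_kern_le (A : OpMInf E) (p : Phase E × Phase E) :
    ‖kern A p‖ ≤ ‖A‖ * ‖(gaussM1 : M1 E)‖ * ‖(gaussM1 : M1 E)‖ := by
  have := A.le_opNorm₂ (atom p.1) (atom p.2)
  rwa [norm_atom, norm_atom] at this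

theorem apply_eq_integral_left (A : OpMInf E) (h k : M1 E) :
    A h k = ∫ w, embed h (atom w) * A (atom w) k := by
  have hI := integrable_smul_atom (integrable_embed_atom h)
  have h1 := (A.flip k).integral_comp_comm hI
  rw [integral_smul_atom] at h1
  rw [← A.flip_apply, ← h1]
  refine integral_congr_ae (ae_of_all _ fun z => ?_)
  simp

theorem apply_eq_integral_right (A : OpMInf E) (h k : M1 E) :
    A h k = ∫ z, conj (embed k (atom z)) * A h (atom z) := by
  have hI := integrable_smul_atom (integrable_embed_atom k)
  have h1 := MInf_integral_comp_comm (A h) hI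
  rw [integral_smul_atom] at h1
  rw [← h1]
  refine integral_congr_ae (ae_of_all _ fun z => ?_)
  simp

theorem integrable_mul_kern (A : OpMInf E) (h k : M1 E) :
    Integrable fun p : Phase E × Phase E =>
      embed h (atom p.1) * conj (embed k (atom p.2)) * kern A p := by
  have h1 : Integrable fun z : Phase E => conj (embed k (atom z)) :=
    (Complex.conjCLE.toContinuousLinearMap).integrable_comp (integrable_embed_atom k)
  exact ((integrable_embed_atom h).mul_prod h1).mul_bdd
    (continuous_kern A).aestronglyMeasurable (ae_of_all _ (norm_kern_le A))

theorem apply_eq_integral (A : OpMInf E) (h k : M1 E) :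
    A h k = ∫ p : Phase E × Phase E, embed h (atom p.1) * conj (embed k (atom p.2)) * kern A p := by
  have hI := integrable_mul_kern A h k
  rw [Measure.volume_eq_prod] at hI ⊢
  rw [integral_prod _ hI, apply_eq_integral_left]
  refine integral_congr_ae (ae_of_all _ fun w => ?_)
  simp only [mul_assoc]
  rw [integral_const_mul, apply_eq_integral_right A (atom w) k]
  rfl

theorem integral_norm_mul_kern_le (A : OpMInf E) (h k : M1 E) :
    ∫ p : Phase E × Phase E, ‖embed h (atom p.1) * conj (embed k (atom p.2)) * kern A p‖ ≤
      (‖h‖ * ‖k‖) * (‖A‖ * ‖(gaussM1 : M1 E)‖ * ‖(gaussM1 : M1 E)‖) := by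
  have hi : Integrable fun p : Phase E × Phase E =>
      ‖embed h (atom p.1)‖ * ‖embed k (atom p.2)‖ :=
    (integrable_embed_atom h).norm.mul_prod (integrable_embed_atom k).norm
  rw [← integral_norm_embed_atom h, ← integral_norm_embed_atom k, ← integral_prod_mul,
    ← integral_mul_const]
  refine integral_mono (integrable_mul_kern A h k).norm (hi.mul_const _) fun p => ?_
  simp only [norm_mul, RCLike.norm_conj]
  exact mul_le_mul_of_nonneg_left (norm_kern_le A p) (by positivity)

/-- The trace of `T A` in terms of matrix elements in the time-frequency shifted Gaussians. -/
theorem hasSum_trace {A : OpMInf E} {f g : ℕ → M1 E} (hfg : IsNuclearRep A f g) (T : OpMInf E) :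
    HasSum (fun n => T (f n) (g n)) (∫ p : Phase E × Phase E, kern A p.swap * kern T p) := by
  have h := hasSum_integral_of_summable_integral_norm
    (F := fun n (p : Phase E × Phase E) =>
      embed (f n) (atom p.1) * conj (embed (g n) (atom p.2)) * kern T p) (μ := volume)
    (fun n => integrable_mul_kern T (f n) (g n))
    ((hfg.1.mul_right _).of_nonneg_of_le (fun n => integral_nonneg fun p => norm_nonneg _)
      fun n => integral_norm_mul_kern_le T (f n) (g n))
  simp only [← apply_eq_integral, tsum_mul_right] at h
  -- Summed under the integral, the rank-one terms give back a matrix element of `A` itself. The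
  -- chosen representation disappears, which is why the trace does not depend on it.
  have h2 : ∀ p : Phase E × Phase E, ∑' n, embed (f n) (atom p.1) * conj (embed (g n) (atom p.2)) =
      kern A p.swap := fun p => by
    change _ = A (atom p.2) (atom p.1)
    rw [← (hfg.2 (atom p.2) (atom p.1)).tsum_eq]
    refine tsum_congr fun n => ?_
    rw [embed_conj_symm, mul_comm]
  simpa only [h2] using h

theorem norm_integral_atom_le {s : Set (Phase E)} (hs : volume s < ⊤) :
    ‖∫ w in s, atom w‖ ≤ ‖(gaussM1 : M1 E)‖ * volume.real s :=
  norm_setIntegral_le_of_norm_le_const hs fun w _ => (norm_atom w).le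

/-- An operator with integrable matrix elements is nuclear. -/
theorem exists_isNuclearRep {A : OpMInf E} (hA : Integrable (kern A)) :
    ∃ f g : ℕ → M1 E, IsNuclearRep A f g := by
  have h1 : Integrable (fun p : Phase E × Phase E => kern A p • atom p.2) := by
    refine (hA.norm.mul_const ‖(gaussM1 : M1 E)‖).mono'
      (hA.1.smul (continuous_atom.comp continuous_snd).aestronglyMeasurable)
      (ae_of_all _ fun p => ?_)
    rw [norm_smul, norm_atom]
  have hA' := hA
  rw [Measure.volume_eq_prod] at h1 hA'
  -- For almost every `w`, `F w` represents `A π(w)φ₀` by an element of `M¹`, so that `A = ∫ F(w) ⊗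
  -- π(w)φ₀ dw`. Decomposing `F` into values `a i` on sets `s i` turns this into `∑ a i ⊗ b i`, with
  -- `b i` the integral of the atoms over `s i`.
  set F : Phase E → M1 E := fun w => ∫ z, kern A (w, z) • atom z with hF
  have hFi : Integrable F := h1.integral_prod_left
  have hFA : ∀ᵐ w, ∀ k, embed (F w) k = A (atom w) k := by
    filter_upwards [hA'.prod_right_ae] with w hw k
    rw [hF, ← embed.flip_apply, ← (embed.flip k).integral_comp_comm (integrable_smul_atom hw),
      apply_eq_integral_right]
    refine integral_congr_ae (ae_of_all _ fun z => ?_)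
    simp [kern, embed_conj_symm, mul_comm]
  obtain ⟨ι, hι, a, s, hsm, hsf, hsum, hdec⟩ := exists_simple_decomposition hFi
  obtain ⟨c, hc⟩ := exists_injective_nat ι
  set b : ι → M1 E := fun i => ∫ w in s i, atom w with hb
  have hbn : ∀ i, ‖a i‖ * ‖b i‖ ≤ ‖(gaussM1 : M1 E)‖ * (‖a i‖ * volume.real (s i)) := fun i => by
    rcases hsf i with h0 | hfin
    · simp [h0]
    · calc _ ≤ ‖a i‖ * (‖(gaussM1 : M1 E)‖ * volume.real (s i)) :=
            mul_le_mul_of_nonneg_left (norm_integral_atom_le hfin) (norm_nonneg _)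
        _ = _ := by ring
  refine ⟨Function.extend c a 0, Function.extend c b 0, ?_, fun h k => ?_⟩
  · have h2 : (fun n => ‖Function.extend c a 0 n‖ * ‖Function.extend c b 0 n‖) =
        Function.extend c (fun i => ‖a i‖ * ‖b i‖) 0 := by
      funext n
      by_cases hn : ∃ i, c i = n
      · obtain ⟨i, rfl⟩ := hn
        simp only [hc.extend_apply]
      · simp [Function.extend_apply' _ _ _ hn]
    rw [h2]
    exact (summable_extend_zero hc).2
      ((hsum.mul_left _).of_nonneg_of_le (fun i => by positivity) hbn)
  · have h2 : (fun n => embed h (Function.extend c b 0 n) * embed (Function.extend c a 0 n) k) =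
        Function.extend c (fun i => embed h (b i) * embed (a i) k) 0 := by
      funext n
      by_cases hn : ∃ i, c i = n
      · obtain ⟨i, rfl⟩ := hn
        simp only [hc.extend_apply]
      · simp [Function.extend_apply' _ _ _ hn]
    rw [h2, hasSum_extend_zero hc]
    have h3 := hdec (embed.flip k) (fun w => embed h (atom w))
      (continuous_embed_atom h).aestronglyMeasurable _ (by positivity) (norm_embed_atom_le h)
    have h4 : ∫ w, (embed.flip k) (F w) * embed h (atom w) = A h k := by
      rw [apply_eq_integral_left]
      refine integral_congr_ae ?_
      filter_upwards [hFA] with w hw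
      rw [ContinuousLinearMap.flip_apply, hw k, mul_comm]
    rw [h4] at h3
    have h5 : ∀ i, embed h (b i) * embed (a i) k =
        (embed.flip k) (a i) * ∫ w in s i, embed h (atom w) := by
      intro i
      rw [ContinuousLinearMap.flip_apply]
      rcases hsf i with h0 | hfin
      · simp [h0]
      · have hI : IntegrableOn (fun w => (atom w : M1 E)) (s i) :=
          IntegrableOn.of_bound hfin continuous_atom.aestronglyMeasurable.restrict
            ‖(gaussM1 : M1 E)‖ (ae_of_all _ fun w => (norm_atom w).le)
        rw [MInf_integral_comp_comm (embed h) hI, mul_comm]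
    simp only [h5]
    exact h3

end Kernel

/-! ### The short-time Fourier transform with squared Gaussian window. -/

section WindowedFourier

variable {E : Type*} [NormedAddCommGroup E] [InnerProductSpace ℝ E] [FiniteDimensional ℝ E]
  [MeasurableSpace E] [BorelSpace E]

theorem fourier_inversion_e {h : E → ℂ} (hc : Continuous h) (hi : Integrable h)
    (hF : Integrable fun w => ∫ s, h s * e (-inner ℝ w s)) (t : E) :
    ∫ w, (∫ s, h s * e (-inner ℝ w s)) * e (inner ℝ w t) = h t := by
  have hF' : FourierTransform.fourier h = fun w => ∫ s, h s * e (-inner ℝ w s) :=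
    funext fun w => fourier_eq_integral_e h w
  have hinv := hc.fourierInv_fourier_eq hi (by rw [hF']; exact hF)
  rw [hF'] at hinv
  have := congrFun hinv t
  rw [fourierInv_eq_integral_e] at this
  rw [← this]
  refine integral_congr_ae (ae_of_all _ fun w => ?_)
  simp only [real_inner_comm]

theorem fourier_gauss (w : E) : ∫ t : E, (gauss t : ℂ) * e (inner ℝ t w) = (gauss w : ℂ) := by
  have h : ∀ t : E, (gauss t : ℂ) * e (inner ℝ t w) =
      (((2 : ℝ) ^ ((Module.finrank ℝ E : ℝ) / 4) : ℝ) : ℂ) *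
        (((Real.exp (-Real.pi * ‖t‖ ^ 2) : ℝ) : ℂ) * e (-inner ℝ (-w) t)) := fun t => by
    rw [gauss, inner_neg_left, neg_neg, real_inner_comm]
    push_cast
    ring
  simp only [h]
  rw [integral_const_mul, integral_exp_mul_e Real.pi_pos, ← Complex.ofReal_mul, gauss]
  congr 2
  rw [div_self Real.pi_pos.ne', Real.one_rpow, one_mul, norm_neg]
  congr 1
  have := Real.pi_pos.ne'
  field_simp

/-- The short-time Fourier transform with the squared Gaussian window. -/
def stftSq (f : E → ℂ) (w : E × E) : ℂ :=
  ∫ t, f t * ((gauss (t - w.1) * gauss (t - w.1) : ℝ) : ℂ) * e (-inner ℝ w.2 t)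

theorem integrable_mul_gauss {f : E → ℂ} (hf : Integrable f) (x : E) :
    Integrable fun t => f t * (gauss (t - x) : ℂ) := by
  have h := stft_integrand hf (x, (0 : E))
  simpa [e] using h

theorem integrable_mul_gauss_sq {f : E → ℂ} (hf : Integrable f) (x : E) :
    Integrable fun t => f t * ((gauss (t - x) * gauss (t - x) : ℝ) : ℂ) := by
  have h := integrable_mul_gauss (integrable_mul_gauss hf x) x
  simpa [mul_assoc] using h

/-- The Gaussian is its own Fourier transform. Writing one of the two window factors as a Fourier
integral turns the product of windows into a Gaussian average over frequency shifts of `stft f`. -/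
theorem stftSq_eq {f : E → ℂ} (hf : Integrable f) (w : E × E) : stftSq f w =
    ∫ ξ, (gauss ξ : ℂ) * e (-inner ℝ ξ w.1) * stft f (w.1, w.2 - ξ) := by
  have h1 : ∀ t, f t * ((gauss (t - w.1) * gauss (t - w.1) : ℝ) : ℂ) * e (-inner ℝ w.2 t) =
      ∫ ξ, f t * (gauss (t - w.1) : ℂ) * e (-inner ℝ w.2 t) *
        ((gauss ξ : ℂ) * e (inner ℝ ξ (t - w.1))) := fun t => by
    rw [integral_const_mul, fourier_gauss]
    push_cast
    ring
  rw [stftSq]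
  simp only [h1]
  rw [integral_integral_swap]
  · refine integral_congr_ae (ae_of_all _ fun ξ => ?_)
    change ∫ t, _ = (gauss ξ : ℂ) * e (-inner ℝ ξ w.1) * stft f (w.1, w.2 - ξ)
    rw [stft, ← integral_const_mul]
    refine integral_congr_ae (ae_of_all _ fun t => ?_)
    have h2 : e (-inner ℝ w.2 t) * e (inner ℝ ξ (t - w.1)) =
        e (-inner ℝ ξ w.1) * e (-inner ℝ (w.2 - ξ) t) := by
      rw [← e_add, ← e_add]
      congr 1
      simp only [inner_sub_left, inner_sub_right]
      ring
    linear_combination (f t * (gauss (t - w.1) : ℂ) * (gauss ξ : ℂ)) * h2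
  · have h3 : Integrable (fun p : E × E => (f p.1 * (gauss (p.1 - w.1) : ℂ) *
        e (-inner ℝ w.2 p.1)) * (gauss p.2 : ℂ)) (volume.prod volume) :=
      (stft_integrand hf w).mul_prod gauss_integrable.ofReal
    have h4 := h3.mul_bdd (c := 1) (g := fun p : E × E => e (inner ℝ p.2 (p.1 - w.1)))
      (e_continuous.comp (by fun_prop)).aestronglyMeasurable (ae_of_all _ fun p => (e_norm _).le)
    refine h4.congr (ae_of_all _ fun p => ?_)
    simp only [Function.uncurry]
    ring

/-- By `stftSq_eq` this is a marginal of a function on `E × (E × E)` which, up to a unimodular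
factor and a measure preserving shear, is the tensor product of `φ₀` and `stft f`. -/
theorem integrable_stftSq (f : M1 E) : Integrable (stftSq f) := by
  have h1 : Integrable (fun p : E × (E × E) => (gauss p.1 : ℂ) * stft f p.2)
      ((volume : Measure E).prod (volume : Measure (E × E))) :=
    (gauss_integrable.ofReal (𝕜 := ℂ)).mul_prod f.integrable_stft
  have hmp : MeasurePreserving (fun p : E × (E × E) => (p.1, p.2 - ((0 : E), p.1)))
      ((volume : Measure E).prod (volume : Measure (E × E)))
      ((volume : Measure E).prod (volume : Measure (E × E))) := by
    refine (MeasurePreserving.id (volume : Measure E)).skew_product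
      (g := fun ξ (q : E × E) => q - ((0 : E), ξ)) ?_ (ae_of_all _ fun ξ => ?_)
    · exact Continuous.measurable (by unfold Function.uncurry; fun_prop)
    · exact (measurePreserving_sub_right (volume : Measure (E × E)) ((0 : E), ξ)).map_eq
  have h2 := (hmp.integrable_comp h1.1).2 h1
  have h3 := h2.bdd_mul (c := 1) (f := fun p : E × (E × E) => e (-inner ℝ p.1 p.2.1))
    (e_continuous.comp (by fun_prop)).aestronglyMeasurable (ae_of_all _ fun p => (e_norm _).le)
  refine h3.integral_prod_right.congr (ae_of_all _ fun w => ?_)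
  rw [stftSq_eq f.integrable]
  refine integral_congr_ae (ae_of_all _ fun ξ => ?_)
  have h5 : w - ((0 : E), ξ) = (w.1, w.2 - ξ) := by
    ext <;> simp
  simp only [Function.comp, h5]
  ring

/-- The window `φ₀²` is again `L²`-normalised, in every dimension `n`: the constant `2ⁿ` cancels the
`4^{-n/2}` from the Gaussian integral. -/
theorem integral_gauss_pow_four :
    ∫ t : E, (gauss t * gauss t) * (gauss t * gauss t) = 1 := by
  have h : ∀ t : E, (((gauss t * gauss t) * (gauss t * gauss t) : ℝ) : ℂ) =
      (((4 : ℝ) ^ ((Module.finrank ℝ E : ℝ) / 2) : ℝ) : ℂ) *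
        (((Real.exp (-(4 * Real.pi) * ‖t‖ ^ 2) : ℝ) : ℂ) * e (-inner ℝ (0 : E) t)) := fun t => by
    have := gauss_add_mul_gauss_sub t (0 : E)
    rw [add_zero, sub_zero, norm_zero] at this
    rw [this, inner_zero_left, neg_zero, e_zero, mul_one, ← Complex.ofReal_mul]
    congr 1
    have h4 : (4 : ℝ) ^ ((Module.finrank ℝ E : ℝ) / 2) =
        (2 : ℝ) ^ ((Module.finrank ℝ E : ℝ) / 2) * (2 : ℝ) ^ ((Module.finrank ℝ E : ℝ) / 2) := by
      rw [← Real.mul_rpow (by norm_num) (by norm_num)]; norm_num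
    have h5 : Real.exp (-(4 * Real.pi) * ‖t‖ ^ 2) =
        Real.exp (-(2 * Real.pi) * ‖t‖ ^ 2) * Real.exp (-(2 * Real.pi) * ‖t‖ ^ 2) := by
      rw [← Real.exp_add]; congr 1; ring
    rw [h4, h5]
    simp
    ring
  have h2 : ((∫ t : E, (gauss t * gauss t) * (gauss t * gauss t) : ℝ) : ℂ) = 1 := by
    rw [← integral_complex_ofReal]
    simp only [h]
    rw [integral_const_mul, integral_exp_mul_e (by positivity), ← Complex.ofReal_mul, ← mul_assoc,
      ← Real.mul_rpow (by norm_num) (by positivity)]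
    have : 4 * (Real.pi / (4 * Real.pi)) = 1 := by
      have := Real.pi_pos.ne'
      field_simp
    rw [this]
    simp
  exact_mod_cast h2

end WindowedFourier

/-! ### Wigner distributions of coherent states and the parity operator. -/

section Wigner

variable {E : Type*} [NormedAddCommGroup E] [InnerProductSpace ℝ E] [FiniteDimensional ℝ E]
  [MeasurableSpace E] [BorelSpace E]

theorem fst_add (a b : Phase E) : (a + b).fst = a.fst + b.fst := rfl
theorem snd_add (a b : Phase E) : (a + b).snd = a.snd + b.snd := rfl
theorem fst_sub (a b : Phase E) : (a - b).fst = a.fst - b.fst := rfl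
theorem snd_sub (a b : Phase E) : (a - b).snd = a.snd - b.snd := rfl
theorem fst_neg (a : Phase E) : (-a).fst = -a.fst := rfl
theorem fst_smul (c : ℝ) (a : Phase E) : (c • a).fst = c • a.fst := rfl
theorem snd_smul (c : ℝ) (a : Phase E) : (c • a).snd = c • a.snd := rfl

theorem finrank_phase : Module.finrank ℝ (Phase E) = 2 * Module.finrank ℝ E := by
  rw [(WithLp.linearEquiv 2 ℝ (E × E)).finrank_eq, Module.finrank_prod, two_mul]

theorem gauss_phase_mul_self (u : Phase E) : gauss u * gauss u =
    ((2 : ℝ) ^ ((Module.finrank ℝ E : ℝ) / 2) * Real.exp (-(2 * Real.pi) * ‖u.fst‖ ^ 2)) *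
    ((2 : ℝ) ^ ((Module.finrank ℝ E : ℝ) / 2) * Real.exp (-(2 * Real.pi) * ‖u.snd‖ ^ 2)) := by
  have h := gauss_add_mul_gauss_sub u (0 : Phase E)
  rw [add_zero, sub_zero, norm_zero] at h
  have h2 : ‖u‖ ^ 2 = ‖u.fst‖ ^ 2 + ‖u.snd‖ ^ 2 := WithLp.prod_norm_sq_eq_of_L2 u
  have h3 : (2 : ℝ) ^ ((Module.finrank ℝ (Phase E) : ℝ) / 2) =
      (2 : ℝ) ^ ((Module.finrank ℝ E : ℝ) / 2) * (2 : ℝ) ^ ((Module.finrank ℝ E : ℝ) / 2) := by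
    rw [← Real.rpow_add (by norm_num), finrank_phase]
    congr 1
    push_cast
    ring
  rw [h, h2, h3, mul_add, Real.exp_add]
  simp
  ring

/-- Translating `t` by `v.fst` centres both Gaussians at `u.fst - m.fst ± t/2`; their product
splits, and the remaining integral in `t` is a Fourier transform. The outcome is a modulation of
`φ₀²` centred at `m`, which is why symbols are analysed with the squared window. -/
theorem wigner_atom (m v u : Phase E) :
    wigner (atom (m + (1 / 2 : ℝ) • v)) (atom (m - (1 / 2 : ℝ) • v)) u =
      e (symp v u) * e (inner ℝ m.snd v.fst) * ((gauss (u - m) * gauss (u - m) : ℝ) : ℂ) := by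
  rw [wigner, ← integral_add_right_eq_self (μ := (volume : Measure E)) _ v.fst]
  have h1 : ∀ t : E, atom (m + (1 / 2 : ℝ) • v) (u.fst + (1 / 2 : ℝ) • (t + v.fst)) *
      conj (atom (m - (1 / 2 : ℝ) • v) (u.fst - (1 / 2 : ℝ) • (t + v.fst))) *
        e (-inner ℝ u.snd (t + v.fst)) =
      (e (symp v u) * e (inner ℝ m.snd v.fst) *
        (((2 : ℝ) ^ ((Module.finrank ℝ E : ℝ) / 2) *
          Real.exp (-(2 * Real.pi) * ‖u.fst - m.fst‖ ^ 2) : ℝ) : ℂ)) *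
      (((Real.exp (-(Real.pi / 2) * ‖t‖ ^ 2) : ℝ) : ℂ) * e (-inner ℝ (u.snd - m.snd) t)) := by
    intro t
    simp only [atom_apply, fst_add, snd_add, fst_sub, snd_sub, fst_smul, snd_smul, map_mul, conj_e,
      Complex.conj_ofReal]
    have a1 : u.fst + (1 / 2 : ℝ) • (t + v.fst) - (m.fst + (1 / 2 : ℝ) • v.fst) =
        (u.fst - m.fst) + (1 / 2 : ℝ) • t := by module
    have a2 : u.fst - (1 / 2 : ℝ) • (t + v.fst) - (m.fst - (1 / 2 : ℝ) • v.fst) =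
        (u.fst - m.fst) - (1 / 2 : ℝ) • t := by module
    have a3 := congrArg (fun r : ℝ => (r : ℂ))
      (gauss_add_mul_gauss_sub (u.fst - m.fst) ((1 / 2 : ℝ) • t))
    have a4 : -(2 * Real.pi) * ‖(1 / 2 : ℝ) • t‖ ^ 2 = -(Real.pi / 2) * ‖t‖ ^ 2 := by
      rw [norm_smul]; norm_num; ring
    rw [a4] at a3
    rw [a1, a2]
    have a5 : e (inner ℝ (m.snd + (1 / 2 : ℝ) • v.snd) (u.fst + (1 / 2 : ℝ) • (t + v.fst))) *
        e (-inner ℝ (m.snd - (1 / 2 : ℝ) • v.snd) (u.fst - (1 / 2 : ℝ) • (t + v.fst))) *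
        e (-inner ℝ u.snd (t + v.fst)) =
        e (symp v u) * e (inner ℝ m.snd v.fst) * e (-inner ℝ (u.snd - m.snd) t) := by
      simp only [← e_add]
      congr 1
      simp only [symp, inner_add_left, inner_add_right, inner_sub_left, inner_sub_right,
        real_inner_smul_left, real_inner_smul_right]
      rw [real_inner_comm u.fst v.snd, real_inner_comm v.fst u.snd]
      ring
    push_cast at a3 ⊢
    linear_combination (e (inner ℝ (m.snd + (1 / 2 : ℝ) • v.snd)
        (u.fst + (1 / 2 : ℝ) • (t + v.fst))) *
        e (-inner ℝ (m.snd - (1 / 2 : ℝ) • v.snd) (u.fst - (1 / 2 : ℝ) • (t + v.fst))) *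
        e (-inner ℝ u.snd (t + v.fst))) * a3 + ((((2 : ℝ) ^ ((Module.finrank ℝ E : ℝ) / 2) : ℝ) : ℂ) *
          Complex.exp (-(2 * Real.pi) * ‖u.fst - m.fst‖ ^ 2) *
          Complex.exp (-(Real.pi / 2) * ‖t‖ ^ 2)) * a5
  simp only [h1]
  rw [integral_const_mul, integral_exp_mul_e (by positivity), mul_assoc, ← Complex.ofReal_mul,
    gauss_phase_mul_self, fst_sub, snd_sub]
  congr 4
  · congr 1
    have := Real.pi_pos.ne'
    field_simp
  · have := Real.pi_pos.ne'
    field_simp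

theorem conj_wigner (f g : E → ℂ) (u : Phase E) : conj (wigner f g u) = wigner g f u := by
  rw [wigner, wigner, ← integral_conj, ← integral_neg_eq_self]
  refine integral_congr_ae (ae_of_all _ fun t => ?_)
  simp only [map_mul, conj_e, Complex.conj_conj, smul_neg, inner_neg_right, neg_neg,
    sub_neg_eq_add, ← sub_eq_add_neg]
  ring

/-- The substitution `s = u.fst - t/2`, with Jacobian `2^d`, reads the Wigner distribution at `u` as
a matrix element of the reflection about `u`. Thus this multiple of `π(2u)P` is the Weyl
quantisation of the point mass at `u`. -/
theorem wigner_eq_shiftParity (f g : M1 E) (u : Phase E) :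
    conj (wigner g f u) = (2 : ℂ) ^ Module.finrank ℝ E * e (-(2 * inner ℝ u.fst u.snd)) *
      shiftParity ((2 : ℝ) • u) f g := by
  rw [conj_wigner, wigner]
  have h1 := Measure.integral_comp_smul (volume : Measure E)
    (fun s => f (u.fst + s) * conj (g (u.fst - s)) * e (-inner ℝ u.snd ((2 : ℝ) • s)))
    (1 / 2 : ℝ)
  simp only [smul_smul] at h1
  norm_num at h1
  norm_num
  rw [h1, ← integral_sub_left_eq_self _ (volume : Measure E) u.fst, mul_assoc]
  congr 1
  · rw [one_div, inv_pow, inv_inv]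
  change _ = e _ * ∫ s, (e (inner ℝ ((2 : ℝ) • u).snd s) * f (-(s - ((2 : ℝ) • u).fst))) * conj (g s)
  rw [← integral_const_mul]
  refine integral_congr_ae (ae_of_all _ fun s => ?_)
  have a1 : u.fst + (u.fst - s) = -(s - ((2 : ℝ) • u).fst) := by
    rw [fst_smul]; module
  have a2 : e (-(2 * inner ℝ u.snd (u.fst - s))) =
      e (-(2 * inner ℝ u.fst u.snd)) * e (inner ℝ ((2 : ℝ) • u).snd s) := by
    rw [← e_add, snd_smul, real_inner_smul_left, inner_sub_right, real_inner_comm u.snd u.fst]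
    congr 1
    ring
  simp only [a1, real_inner_smul_right, a2, sub_sub_cancel]
  ring

end Wigner

/-! ### Symplectic rotation and midpoint coordinates. -/

section PhaseMaps

variable {E : Type*} [NormedAddCommGroup E] [InnerProductSpace ℝ E] [FiniteDimensional ℝ E]
  [MeasurableSpace E] [BorelSpace E]

/-- The rotation `(x, ω) ↦ (ω, -x)` of phase space, for which `⟨J v, u⟩ = Ω(v, u)`. -/
def rot : Phase E ≃ₗᵢ[ℝ] Phase E where
  toFun v := WithLp.toLp 2 (v.snd, -v.fst)
  invFun v := WithLp.toLp 2 (-v.snd, v.fst)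
  map_add' a b := by
    change WithLp.toLp 2 (a.snd + b.snd, -(a.fst + b.fst)) =
      WithLp.toLp 2 (a.snd + b.snd, -a.fst + -b.fst)
    rw [neg_add]
  map_smul' c a := by
    change WithLp.toLp 2 (c • a.snd, -(c • a.fst)) = WithLp.toLp 2 (c • a.snd, c • -a.fst)
    rw [smul_neg]
  left_inv v := by
    change WithLp.toLp 2 (- -v.fst, v.snd) = v
    rw [neg_neg]; rfl
  right_inv v := by
    change WithLp.toLp 2 (v.fst, - -v.snd) = v
    rw [neg_neg]; rfl
  norm_map' v := by
    change ‖WithLp.toLp 2 (v.snd, -v.fst)‖ = ‖v‖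
    have h1 := WithLp.prod_norm_sq_eq_of_L2 v
    have h2 := WithLp.prod_norm_sq_eq_of_L2 (WithLp.toLp 2 (v.snd, -v.fst))
    have h3 : ‖WithLp.toLp 2 (v.snd, -v.fst)‖ ^ 2 = ‖v‖ ^ 2 := by
      rw [h1, h2]
      change ‖v.snd‖ ^ 2 + ‖-v.fst‖ ^ 2 = _
      rw [norm_neg, add_comm]
    exact (sq_eq_sq₀ (norm_nonneg _) (norm_nonneg _)).1 h3

theorem inner_rot (v u : Phase E) : inner ℝ (rot v) u = symp v u := by
  rw [WithLp.prod_inner_apply, symp]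
  change inner ℝ v.snd u.fst + inner ℝ (-v.fst) u.snd = _
  rw [inner_neg_left, real_inner_comm]; rfl

theorem rot_rot (v : Phase E) : rot (rot v) = -v := rfl

theorem symp_swap (a b : Phase E) : symp a b = -symp b a := by
  rw [symp, symp, real_inner_comm a.snd, real_inner_comm b.snd]; ring

/-- The change of variables `(m, v) ↦ (m + v/2, m - v/2)`. -/
def midpointHomeo : Phase E × Phase E ≃ₜ Phase E × Phase E where
  toFun p := (p.1 + (1 / 2 : ℝ) • p.2, p.1 - (1 / 2 : ℝ) • p.2)
  invFun p := ((1 / 2 : ℝ) • (p.1 + p.2), p.1 - p.2)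
  left_inv p := by ext1 <;> dsimp <;> module
  right_inv p := by ext1 <;> dsimp <;> module
  continuous_toFun := by fun_prop
  continuous_invFun := by fun_prop

/-- The map factors into swaps, a shear and the map `(a, v) ↦ (a, a - v)`, each of which preserves
measure fibre by fibre, so no determinant is computed. -/
theorem measurePreserving_midpoint :
    MeasurePreserving (midpointHomeo (E := E)) volume volume := by
  rw [Measure.volume_eq_prod]
  have h1 : MeasurePreserving (fun p : Phase E × Phase E => (p.1, p.2 + (1 / 2 : ℝ) • p.1))
      (volume.prod volume) (volume.prod volume) :=
    (MeasurePreserving.id (volume : Measure (Phase E))).skew_product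
      (g := fun v m => m + (1 / 2 : ℝ) • v)
      (Continuous.measurable (by unfold Function.uncurry; fun_prop))
      (ae_of_all _ fun v => (measurePreserving_add_right volume ((1 / 2 : ℝ) • v)).map_eq)
  have h2 : MeasurePreserving (fun p : Phase E × Phase E => (p.1, p.1 - p.2))
      (volume.prod volume) (volume.prod volume) :=
    (MeasurePreserving.id (volume : Measure (Phase E))).skew_product
      (g := fun a v => a - v)
      (Continuous.measurable (by unfold Function.uncurry; fun_prop))
      (ae_of_all _ fun a => (Measure.measurePreserving_sub_left volume a).map_eq)
  have h3 := h2.comp (Measure.measurePreserving_swap.comp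
    (h1.comp Measure.measurePreserving_swap))
  have h4 : (midpointHomeo (E := E) : Phase E × Phase E → Phase E × Phase E) =
      (fun p => (p.1, p.1 - p.2)) ∘ Prod.swap ∘ (fun p => (p.1, p.2 + (1 / 2 : ℝ) • p.1)) ∘
        Prod.swap := by
    funext p
    change ((_, _) : Phase E × Phase E) = (_, _)
    ext1
    · rfl
    · dsimp; module
  rw [h4]
  exact h3

theorem integral_midpoint (f : Phase E × Phase E → ℂ) :
    ∫ p, f (midpointHomeo p) = ∫ p, f p :=
  measurePreserving_midpoint.integral_comp midpointHomeo.measurableEmbedding f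

theorem integrable_midpoint_iff {f : Phase E × Phase E → ℂ} :
    Integrable (fun p => f (midpointHomeo p)) ↔ Integrable f :=
  measurePreserving_midpoint.integrable_comp_emb midpointHomeo.measurableEmbedding

end PhaseMaps

/-! ### Traces expressed through Weyl symbols. -/

section Symbols

variable {E : Type*} [NormedAddCommGroup E] [InnerProductSpace ℝ E] [FiniteDimensional ℝ E]
  [MeasurableSpace E] [BorelSpace E]

/-- The matrix elements of an operator in midpoint coordinates. -/
def weylKern (T : OpMInf E) (p : Phase E × Phase E) : ℂ :=
  e (-inner ℝ p.1.snd p.2.fst) * kern T (midpointHomeo p)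

theorem continuous_weylKern (T : OpMInf E) : Continuous (weylKern T) :=
  (e_continuous.comp (by fun_prop)).mul ((continuous_kern T).comp midpointHomeo.continuous)

theorem norm_weylKern_le (T : OpMInf E) (p : Phase E × Phase E) :
    ‖weylKern T p‖ ≤ ‖T‖ * ‖(gaussM1 : M1 E)‖ * ‖(gaussM1 : M1 E)‖ := by
  rw [weylKern, norm_mul, e_norm, one_mul]
  exact norm_kern_le T _

/-- The short-time Fourier transform with squared Gaussian window of a symbol, with frequencies
given by the symplectic form. -/
def symbolTransform (τ : Phase E → ℂ) (p : Phase E × Phase E) : ℂ := stftSq τ (p.1, rot p.2)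

theorem integrable_symbolTransform (τ : M1 (Phase E)) : Integrable (symbolTransform τ) := by
  have h := integrable_stftSq τ
  have hmp : MeasurePreserving (fun p : Phase E × Phase E => (p.1, rot p.2)) :=
    (MeasurePreserving.id volume).prod (rot (E := E)).measurePreserving
  exact (hmp.integrable_comp h.1).2 h

/-- Testing the definition of the Weyl symbol on two atoms and inserting `wigner_atom` gives the
transform of `τ` at position `m` and symplectic frequency `v`. The swapped order is the one in which
`A` enters the trace. -/
theorem kern_midpoint_swap {A : OpMInf E} {τ : M1 (Phase E)} (h : IsWeylSymbol A τ)
    (p : Phase E × Phase E) : kern A (midpointHomeo p).swap =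
      e (-inner ℝ p.1.snd p.2.fst) * symbolTransform τ p := by
  change A (atom (p.1 - (1 / 2 : ℝ) • p.2)) (atom (p.1 + (1 / 2 : ℝ) • p.2)) = _
  rw [h, symbolTransform, stftSq, ← integral_const_mul]
  refine integral_congr_ae (ae_of_all _ fun u => ?_)
  simp only [wigner_atom, map_mul, conj_e, Complex.conj_ofReal, inner_rot]
  ring

theorem integrable_kern {A : OpMInf E} {τ : M1 (Phase E)} (h : IsWeylSymbol A τ) :
    Integrable (kern A) := by
  have h1 : Integrable fun p : Phase E × Phase E => kern A p.swap := by
    refine integrable_midpoint_iff.1 ?_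
    simp only [kern_midpoint_swap h]
    exact (integrable_symbolTransform τ).bdd_mul (c := 1)
      (e_continuous.comp (by fun_prop)).aestronglyMeasurable (ae_of_all _ fun p => (e_norm _).le)
  rw [Measure.volume_eq_prod] at h1 ⊢
  exact h1.swap

theorem integral_kern_eq {A : OpMInf E} {τ : M1 (Phase E)} (h : IsWeylSymbol A τ) (T : OpMInf E) :
    ∫ p : Phase E × Phase E, kern A p.swap * kern T p =
      ∫ p : Phase E × Phase E, symbolTransform τ p * weylKern T p := by
  rw [← integral_midpoint]
  refine integral_congr_ae (ae_of_all _ fun p => ?_)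
  simp only [kern_midpoint_swap h, weylKern]
  ring

/-- `hasSum_trace` evaluates every nuclear representation to the same integral, and one exists
because a symbol in `M¹` has integrable matrix elements. -/
theorem isTraceMul_iff {A : OpMInf E} {τ : M1 (Phase E)} (h : IsWeylSymbol A τ) (T : OpMInf E)
    (t : ℂ) : IsTraceMul T A t ↔
      t = ∫ p : Phase E × Phase E, symbolTransform τ p * weylKern T p := by
  rw [← integral_kern_eq h T]
  constructor
  · rintro ⟨f, g, hfg, ht⟩
    exact ht.unique (hasSum_trace hfg T)
  · rintro rfl
    obtain ⟨f, g, hfg⟩ := exists_isNuclearRep (integrable_kern h)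
    exact ⟨f, g, hfg, hasSum_trace hfg T⟩

theorem traceMul_eq {A : OpMInf E} {τ : M1 (Phase E)} (h : IsWeylSymbol A τ) (T : OpMInf E) :
    traceMul T A = ∫ p : Phase E × Phase E, symbolTransform τ p * weylKern T p := by
  have hex : ∃ t, IsTraceMul T A t := ⟨_, (isTraceMul_iff h T _).2 rfl⟩
  rw [traceMul, dif_pos hex]
  exact (isTraceMul_iff h T _).1 hex.choose_spec

theorem integrable_symbolTransform_mul (τ : M1 (Phase E)) (T : OpMInf E) :
    Integrable fun p : Phase E × Phase E => symbolTransform τ p * weylKern T p :=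
  (integrable_symbolTransform τ).mul_bdd (continuous_weylKern T).aestronglyMeasurable
    (ae_of_all _ (norm_weylKern_le T))

theorem ae_integrable_symbolTransform (τ : M1 (Phase E)) :
    ∀ᵐ m : Phase E, Integrable fun v => symbolTransform τ (m, v) := by
  have h := integrable_symbolTransform τ
  rw [Measure.volume_eq_prod] at h
  exact h.prod_right_ae

/-- The windowed symbol `u ↦ τ(u) φ₀(u - m)²`. -/
def windowed (τ : Phase E → ℂ) (m u : Phase E) : ℂ :=
  τ u * ((gauss (u - m) * gauss (u - m) : ℝ) : ℂ)

/-- For fixed `m`, `symbolTransform τ (m, ·)` is the Fourier transform of the windowed symbol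
composed with the isometry `rot`, so Fourier inversion holds with symplectic characters. -/
theorem integral_symbolTransform_mul_e (τ : M1 (Phase E)) {m : Phase E}
    (hm : Integrable fun v => symbolTransform τ (m, v)) (u : Phase E) :
    ∫ v, symbolTransform τ (m, v) * e (symp v u) = windowed τ m u := by
  have hc : Continuous (windowed τ m) := τ.continuous.mul (Complex.continuous_ofReal.comp
    ((gauss_continuous.comp (by fun_prop)).mul (gauss_continuous.comp (by fun_prop))))
  have hi : Integrable (windowed τ m) := integrable_mul_gauss_sq τ.integrable m
  have hme := (rot (E := E)).toHomeomorph.measurableEmbedding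
  have hF : Integrable fun w => ∫ s, windowed τ m s * e (-inner ℝ w s) :=
    ((rot (E := E)).measurePreserving.integrable_comp_emb hme).1 hm
  have h := fourier_inversion_e hc hi hF u
  have h' := (rot (E := E)).measurePreserving.integral_comp hme
    fun w => (∫ s, windowed τ m s * e (-inner ℝ w s)) * e (inner ℝ w u)
  rw [← h, ← h']
  refine integral_congr_ae (ae_of_all _ fun v => ?_)
  change _ = (∫ s, windowed τ m s * e (-inner ℝ (rot v) s)) * e (inner ℝ (rot v) u)
  rw [inner_rot v u]
  rfl

/-- The phase in `weylKern` is chosen to cancel the factor `e (inner ℝ m.snd v.fst)` of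
`wigner_atom`; a pure symplectic character in `v` remains. -/
theorem weylKern_shiftParity (u : Phase E) (p : Phase E × Phase E) :
    (2 : ℂ) ^ Module.finrank ℝ E * e (-(2 * inner ℝ u.fst u.snd)) *
      weylKern (shiftParity ((2 : ℝ) • u)) p =
    e (symp p.2 u) * ((gauss (u - p.1) * gauss (u - p.1) : ℝ) : ℂ) := by
  have h := wigner_eq_shiftParity (atom (p.1 + (1 / 2 : ℝ) • p.2))
    (atom (p.1 - (1 / 2 : ℝ) • p.2)) u
  rw [conj_wigner, wigner_atom] at h
  rw [weylKern]
  change _ * (e (-inner ℝ p.1.snd p.2.fst) * (shiftParity ((2 : ℝ) • u)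
    (atom (p.1 + (1 / 2 : ℝ) • p.2)) (atom (p.1 - (1 / 2 : ℝ) • p.2)))) = _
  rw [mul_left_comm, ← h]
  linear_combination (e (symp p.2 u) * ((gauss (u - p.1) * gauss (u - p.1) : ℝ) : ℂ)) *
    e_mul_e_neg (inner ℝ p.1.snd p.2.fst)

/-- The parity operator centred at `u` pairs with an operator by evaluating its symbol at `u`. -/
theorem integral_symbolTransform_shiftParity (τ : M1 (Phase E)) (u : Phase E) :
    (2 : ℂ) ^ Module.finrank ℝ E * e (-(2 * inner ℝ u.fst u.snd)) *
      ∫ p : Phase E × Phase E, symbolTransform τ p * weylKern (shiftParity ((2 : ℝ) • u)) p =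
    τ u := by
  have hI := integrable_symbolTransform_mul τ (shiftParity ((2 : ℝ) • u))
  rw [Measure.volume_eq_prod] at hI ⊢
  rw [integral_prod _ hI, ← integral_const_mul]
  -- Inversion in `v` yields the symbol with its window `φ₀²`, and the kernel of the parity operator
  -- contributes another `φ₀²`. The fourth power then integrates to 1 over `m`.
  have h1 : ∀ᵐ m : Phase E, (2 : ℂ) ^ Module.finrank ℝ E * e (-(2 * inner ℝ u.fst u.snd)) *
      ∫ v, symbolTransform τ (m, v) * weylKern (shiftParity ((2 : ℝ) • u)) (m, v) =
      τ u * (((gauss (u - m) * gauss (u - m)) * (gauss (u - m) * gauss (u - m)) : ℝ) : ℂ) := by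
    filter_upwards [ae_integrable_symbolTransform τ] with m hm
    have h2 : ∀ v, (2 : ℂ) ^ Module.finrank ℝ E * e (-(2 * inner ℝ u.fst u.snd)) *
        (symbolTransform τ (m, v) * weylKern (shiftParity ((2 : ℝ) • u)) (m, v)) =
        symbolTransform τ (m, v) * e (symp v u) *
          ((gauss (u - m) * gauss (u - m) : ℝ) : ℂ) := fun v => by
      rw [mul_left_comm, weylKern_shiftParity]
      ring
    rw [← integral_const_mul]
    simp only [h2]
    rw [integral_mul_const, integral_symbolTransform_mul_e τ hm, windowed]
    push_cast
    ring
  rw [integral_congr_ae h1, integral_const_mul, integral_complex_ofReal,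
    integral_sub_left_eq_self
      (fun m : Phase E => (gauss m * gauss m) * (gauss m * gauss m)) volume u,
    integral_gauss_pow_four]
  simp

/-- Complex conjugation on `M¹(E)`. -/
def conjM1 (f : M1 E) : M1 E := ⟨fun t => conj (f t), by
  refine ⟨Complex.continuous_conj.comp f.continuous,
    (Complex.conjCLE.toContinuousLinearMap).integrable_comp f.integrable, ?_⟩
  have h : stft (fun t => conj (f t)) = fun w : E × E => conj (stft f (w.1, -w.2)) := by
    funext w
    rw [stft, stft, ← integral_conj]
    refine integral_congr_ae (ae_of_all _ fun t => ?_)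
    simp only [map_mul, conj_e, Complex.conj_ofReal, inner_neg_left, neg_neg]
  rw [h]
  refine (Complex.conjCLE.toContinuousLinearMap).integrable_comp
    (φ := fun w : E × E => stft f (w.1, -w.2)) ?_
  have hmp : MeasurePreserving (fun w : E × E => (w.1, -w.2)) :=
    (MeasurePreserving.id volume).prod (Measure.measurePreserving_neg volume)
  exact (hmp.integrable_comp f.integrable_stft.1).2 f.integrable_stft⟩

theorem conjM1_apply (f : M1 E) (t : E) : conjM1 f t = conj (f t) := rfl

theorem IsWeylSymbol.opAdjoint {R : OpMInf E} {ρ : M1 (Phase E)} (h : IsWeylSymbol R ρ) :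
    IsWeylSymbol (opAdjoint R) (conjM1 ρ) := by
  intro f g
  rw [opAdjoint_apply, h, ← integral_conj]
  refine integral_congr_ae (ae_of_all _ fun u => ?_)
  simp only [map_mul, conjM1_apply, conj_wigner]

/-- The reflected symbol `u ↦ σ(z - u)`. -/
def reflectM1 (z : E) (σ : M1 E) : M1 E := tfShift (WithLp.toLp 2 (z, 0)) (parity σ)

theorem reflectM1_apply (z : E) (σ : M1 E) (u : E) : reflectM1 z σ u = σ (z - u) := by
  change e (inner ℝ (0 : E) u) * σ (-(u - z)) = _
  rw [inner_zero_left, e_zero, one_mul, neg_sub]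

/-- Covariance of the Wigner distribution: applying `Pπ(z)^*` to both arguments changes the variable
to `z - u`, and the common unimodular factor cancels against its conjugate. -/
theorem IsWeylSymbol.opTranslate_opCheck {S : OpMInf E} {σ : M1 (Phase E)} (h : IsWeylSymbol S σ)
    (z : Phase E) : IsWeylSymbol (opTranslate z (opCheck S)) (reflectM1 z σ) := by
  intro f g
  have h1 : ∀ (k : M1 E) (t : E), parity (tfShiftAdj z k) t =
      e (-inner ℝ z.fst z.snd) * (e (inner ℝ z.snd t) * k (z.fst - t)) := by
    intro k t
    change e (-inner ℝ z.fst z.snd) * (e (inner ℝ (-z.snd) (-t)) * k (-t - -z.fst)) = _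
    have h0 : -t - -z.fst = z.fst - t := by abel
    rw [inner_neg_neg, h0]
  have h2 : ∀ u, wigner (parity (tfShiftAdj z g)) (parity (tfShiftAdj z f)) u =
      wigner g f (z - u) := by
    intro u
    rw [wigner, wigner, ← integral_neg_eq_self]
    refine integral_congr_ae (ae_of_all _ fun t => ?_)
    simp only [h1, map_mul, conj_e, fst_sub, snd_sub, smul_neg, sub_neg_eq_add,
      ← sub_eq_add_neg, neg_neg, inner_neg_right]
    have a1 : z.fst - (u.fst - (1 / 2 : ℝ) • t) = z.fst - u.fst + (1 / 2 : ℝ) • t := by abel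
    have a2 : z.fst - (u.fst + (1 / 2 : ℝ) • t) = z.fst - u.fst - (1 / 2 : ℝ) • t := by abel
    rw [a1, a2]
    have a3 : e (inner ℝ z.snd (u.fst - (1 / 2 : ℝ) • t)) *
        e (-inner ℝ z.snd (u.fst + (1 / 2 : ℝ) • t)) * e (inner ℝ u.snd t) =
        e (-inner ℝ (z.snd - u.snd) t) := by
      rw [← e_add, ← e_add]
      congr 1
      simp only [inner_add_right, inner_sub_right, inner_sub_left, real_inner_smul_right]
      ring
    have a4 : e (-inner ℝ z.fst z.snd) * e (inner ℝ z.fst z.snd) = 1 := by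
      rw [mul_comm, e_mul_e_neg]
    linear_combination
      (g (z.fst - u.fst + (1 / 2 : ℝ) • t) * conj (f (z.fst - u.fst - (1 / 2 : ℝ) • t)) *
        (e (-inner ℝ z.fst z.snd) * e (inner ℝ z.fst z.snd))) * a3 +
      (g (z.fst - u.fst + (1 / 2 : ℝ) • t) * conj (f (z.fst - u.fst - (1 / 2 : ℝ) • t)) *
        e (-inner ℝ (z.snd - u.snd) t)) * a4
  change S (parity (tfShiftAdj z f)) (parity (tfShiftAdj z g)) = _
  rw [h, ← integral_sub_left_eq_self _ (volume : Measure (Phase E)) z]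
  refine integral_congr_ae (ae_of_all _ fun u => ?_)
  simp only [h2, reflectM1_apply, sub_sub_cancel]

end Symbols

/-! ### Periodic functions and Fourier series on the torus. -/

section Torus

variable {V : Type*} [NormedAddCommGroup V] [NormedSpace ℝ V] [FiniteDimensional ℝ V]
  {ι : Type*} [Fintype ι]

/-- The map from a vector space to the torus given by the coordinates in a basis. -/
def toTorus (b : Module.Basis ι ℝ V) (v : V) : UnitAddTorus ι := fun i => (b.repr v i : UnitAddCircle)

theorem isOpenQuotientMap_toTorus (b : Module.Basis ι ℝ V) : IsOpenQuotientMap (toTorus b) := by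
  have h1 : IsOpenQuotientMap (Pi.map fun _ : ι => ((↑) : ℝ → UnitAddCircle)) :=
    IsOpenQuotientMap.piMap fun _ => QuotientAddGroup.isOpenQuotientMap_mk
  exact h1.comp b.equivFunL.toHomeomorph.isOpenQuotientMap

theorem sub_mem_of_toTorus_eq (b : Module.Basis ι ℝ V) {v w : V} (h : toTorus b v = toTorus b w) :
    w - v ∈ Submodule.span ℤ (Set.range b) := by
  rw [b.mem_span_iff_repr_mem ℤ]
  intro i
  have hi : ((b.repr v i : ℝ) : UnitAddCircle) = (b.repr w i : ℝ) := congrFun h i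
  rw [QuotientAddGroup.eq, AddSubgroup.mem_zmultiples_iff] at hi
  obtain ⟨k, hk⟩ := hi
  refine ⟨k, ?_⟩
  rw [map_sub, Finsupp.sub_apply]
  simp only [zsmul_eq_mul, mul_one] at hk
  simp only [algebraMap_int_eq, eq_intCast, hk]
  ring

/-- A continuous function on `X × V` that is periodic in the second variable comes from a
continuous family of functions on the torus. -/
theorem exists_torus_lift {X : Type*} [TopologicalSpace X] (b : Module.Basis ι ℝ V)
    {k : X × V → ℂ} (hk : Continuous k)
    (hper : ∀ x v, ∀ l ∈ Submodule.span ℤ (Set.range b), k (x, v + l) = k (x, v)) :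
    ∃ K : C(X, C(UnitAddTorus ι, ℂ)), ∀ x v, K x (toTorus b v) = k (x, v) := by
  -- Openness matters here: open quotient maps are stable under products, whereas general quotient
  -- maps are not.
  have hq : IsOpenQuotientMap (Prod.map (id : X → X) (toTorus b)) :=
    IsOpenQuotientMap.id.prodMap (isOpenQuotientMap_toTorus b)
  have hfac : Function.FactorsThrough (⟨k, hk⟩ : C(X × V, ℂ))
      (⟨Prod.map (id : X → X) (toTorus b), hq.continuous⟩ : C(X × V, X × UnitAddTorus ι)) := by
    rintro ⟨x, v⟩ ⟨y, w⟩ h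
    have h1 : x = y := congrArg Prod.fst h
    have h2 : toTorus b v = toTorus b w := congrArg Prod.snd h
    subst h1
    change k (x, v) = k (x, w)
    rw [← hper x v _ (sub_mem_of_toTorus_eq b h2), add_sub_cancel]
  have hq' : Topology.IsQuotientMap
      (⟨Prod.map (id : X → X) (toTorus b), hq.continuous⟩ : C(X × V, X × UnitAddTorus ι)) :=
    hq.isQuotientMap
  -- Currying gives continuity of `x ↦ K x` in the uniform norm, hence of each Fourier coefficient
  -- as a function of `x`.
  refine ⟨(hq'.lift _ hfac).curry, fun x v => ?_⟩
  exact congrArg (fun f : C(X × V, ℂ) => f (x, v)) (hq'.lift_comp _ hfac)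

/-- The normalised Haar measure on the torus. -/
def torusMeasure (ι : Type*) [Fintype ι] : Measure (UnitAddTorus ι) :=
  Measure.pi fun _ : ι => (AddCircle.haarAddCircle : Measure UnitAddCircle)

instance : IsProbabilityMeasure (torusMeasure ι) := by unfold torusMeasure; infer_instance

theorem integrable_torus (f : C(UnitAddTorus ι, ℂ)) : Integrable f (torusMeasure ι) :=
  Integrable.of_bound f.continuous.aestronglyMeasurable ‖f‖ (ae_of_all _ f.norm_coe_le_norm)

theorem integral_fourier (n : ℤ) :
    ∫ x : UnitAddCircle, fourier n x ∂AddCircle.haarAddCircle = if n = 0 then 1 else 0 := by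
  have h := orthonormal_iff_ite.1 (orthonormal_fourier (T := 1)) 0 n
  rw [ContinuousMap.inner_toLp] at h
  simp only [fourier_zero, map_one, mul_one] at h
  rw [h]
  simp only [eq_comm]

theorem integral_mFourier (n : ι → ℤ) :
    ∫ x, UnitAddTorus.mFourier n x ∂torusMeasure ι = if n = 0 then 1 else 0 := by
  change ∫ x : ι → UnitAddCircle, ∏ i, fourier (n i) (x i) ∂torusMeasure ι = _
  rw [torusMeasure, integral_fintype_prod_eq_prod (𝕜 := ℂ)
    (f := fun i (x : UnitAddCircle) => (fourier (n i) x : ℂ))]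
  simp only [integral_fourier]
  split_ifs with h
  · simp [h]
  · obtain ⟨i, hi⟩ := Function.ne_iff.mp h
    exact Finset.prod_eq_zero (Finset.mem_univ i) (if_neg hi)

/-- The Fourier coefficient of a continuous function on the torus. -/
def torusCoeff (n : ι → ℤ) : C(UnitAddTorus ι, ℂ) →L[ℂ] ℂ :=
  LinearMap.mkContinuous
    { toFun := fun f => ∫ x, UnitAddTorus.mFourier (-n) x * f x ∂torusMeasure ι
      map_add' := fun f g => by
        simp only [ContinuousMap.add_apply, mul_add]
        exact integral_add (integrable_torus (UnitAddTorus.mFourier (-n) * f))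
          (integrable_torus (UnitAddTorus.mFourier (-n) * g))
      map_smul' := fun c f => by
        simp only [ContinuousMap.smul_apply, smul_eq_mul, mul_left_comm _ c, RingHom.id_apply]
        exact integral_const_mul _ _ }
    1 fun f => by
      have h := norm_integral_le_of_norm_le_const (μ := torusMeasure ι) (C := ‖f‖)
        (f := fun x => UnitAddTorus.mFourier (-n) x * f x) (ae_of_all _ fun x => by
          rw [norm_mul]
          have h1 := (UnitAddTorus.mFourier (-n)).norm_coe_le_norm x
          rw [UnitAddTorus.mFourier_norm] at h1
          exact (mul_le_of_le_one_left (norm_nonneg _) h1).trans (f.norm_coe_le_norm x))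
      simpa using h

theorem norm_torusCoeff_le (n : ι → ℤ) (f : C(UnitAddTorus ι, ℂ)) : ‖torusCoeff n f‖ ≤ ‖f‖ := by
  have h := (torusCoeff n).le_of_opNorm_le (LinearMap.mkContinuous_norm_le _ zero_le_one _) f
  simpa using h

theorem torusCoeff_mFourier (n m : ι → ℤ) :
    torusCoeff n (UnitAddTorus.mFourier m) = if m = n then 1 else 0 := by
  change ∫ x, UnitAddTorus.mFourier (-n) x * UnitAddTorus.mFourier m x ∂torusMeasure ι = _
  simp only [← UnitAddTorus.mFourier_add]
  rw [integral_mFourier]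
  simp only [neg_add_eq_zero, eq_comm]

theorem mFourier_toTorus (b : Module.Basis ι ℝ V) (n : ι → ℤ) (v : V) :
    UnitAddTorus.mFourier n (toTorus b v) = e (∑ i, n i * b.repr v i) := by
  change ∏ i, (fourier (n i) ((b.repr v i : ℝ) : UnitAddCircle) : ℂ) = _
  simp only [fourier_coe_apply]
  rw [e, ← Complex.exp_sum]
  congr 1
  push_cast
  rw [Finset.mul_sum]
  refine Finset.sum_congr rfl fun i _ => ?_
  simp
  ring

variable [MeasurableSpace V] [BorelSpace V] {μ : Measure V}

/-- Integrating a function against a periodic function samples its Fourier transform. -/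
theorem integral_mul_periodic (b : Module.Basis ι ℝ V) {F : V → ℂ} (hF : Integrable F μ)
    {I : Type*} {N : I → ι → ℤ} (hN : Function.Bijective N) {a : I → ℂ}
    (ha : Summable fun i => ‖a i‖)
    (hFa : ∀ i, ∫ v, F v * e (∑ j, N i j * b.repr v j) ∂μ = a i) (k : C(UnitAddTorus ι, ℂ)) :
    ∫ v, F v * k (toTorus b v) ∂μ = ∑' i, a i * torusCoeff (N i) k := by
  have hint : ∀ k : C(UnitAddTorus ι, ℂ), Integrable (fun v => F v * k (toTorus b v)) μ :=
    fun k => hF.mul_bdd (c := ‖k‖)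
      (k.continuous.comp (isOpenQuotientMap_toTorus b).continuous).aestronglyMeasurable
      (ae_of_all _ fun v => k.norm_coe_le_norm _)
  have hb : ∀ (k : C(UnitAddTorus ι, ℂ)) i, ‖a i * torusCoeff (N i) k‖ ≤ ‖a i‖ * ‖k‖ :=
    fun k i => by
      rw [norm_mul]
      exact mul_le_mul_of_nonneg_left (norm_torusCoeff_le _ _) (norm_nonneg _)
  have hs : ∀ k : C(UnitAddTorus ι, ℂ), Summable fun i => a i * torusCoeff (N i) k :=
    fun k => (ha.mul_right ‖k‖).of_norm_bounded (hb k)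
  let L₁ : C(UnitAddTorus ι, ℂ) →L[ℂ] ℂ := LinearMap.mkContinuous
    { toFun := fun k => ∫ v, F v * k (toTorus b v) ∂μ
      map_add' := fun f g => by
        simp only [ContinuousMap.add_apply, mul_add]
        exact integral_add (hint f) (hint g)
      map_smul' := fun c f => by
        simp only [ContinuousMap.smul_apply, smul_eq_mul, mul_left_comm _ c, RingHom.id_apply]
        exact integral_const_mul _ _ }
    (∫ v, ‖F v‖ ∂μ) fun k => by
      rw [← integral_mul_const]
      refine norm_integral_le_of_norm_le (hF.norm.mul_const _) (ae_of_all _ fun v => ?_)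
      rw [norm_mul]
      exact mul_le_mul_of_nonneg_left (k.norm_coe_le_norm _) (norm_nonneg _)
  let L₂ : C(UnitAddTorus ι, ℂ) →L[ℂ] ℂ := LinearMap.mkContinuous
    { toFun := fun k => ∑' i, a i * torusCoeff (N i) k
      map_add' := fun f g => by
        simp only [map_add, mul_add]
        exact (hs f).tsum_add (hs g)
      map_smul' := fun c f => by
        simp only [map_smul, smul_eq_mul, mul_left_comm _ c, RingHom.id_apply]
        exact tsum_mul_left }
    (∑' i, ‖a i‖) fun k => by
      rw [← tsum_mul_right]
      exact tsum_of_norm_bounded (ha.mul_right ‖k‖).hasSum (hb k)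
  -- Both functionals are bounded in the sup norm, and trigonometric polynomials are dense, so it
  -- suffices to compare them on characters, where one term survives. Convergence of the Fourier
  -- series of `k` is never needed.
  have h : L₁ = L₂ := by
    refine ContinuousLinearMap.ext_on
      (s := Set.range (UnitAddTorus.mFourier (d := ι))) ?_ ?_
    · exact Submodule.dense_iff_topologicalClosure_eq_top.2
        UnitAddTorus.span_mFourier_closure_eq_top
    · rintro _ ⟨n, rfl⟩
      obtain ⟨i, rfl⟩ := hN.2 n
      change ∫ v, F v * UnitAddTorus.mFourier (N i) (toTorus b v) ∂μ =
        ∑' j, a j * torusCoeff (N j) (UnitAddTorus.mFourier (N i))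
      simp only [mFourier_toTorus, hFa, torusCoeff_mFourier]
      rw [tsum_eq_single i]
      · simp
      · intro j hj
        rw [if_neg fun h => hj (hN.1 h).symm, mul_zero]
  exact congrArg (fun L : C(UnitAddTorus ι, ℂ) →L[ℂ] ℂ => L k) h

end Torus

/-! ### Sampling functions in Feichtinger's algebra. -/

section SampleSummable

variable {E : Type*} [NormedAddCommGroup E] [InnerProductSpace ℝ E] [FiniteDimensional ℝ E]
  [MeasurableSpace E] [BorelSpace E]

/-- The samples of a function in `M¹` on a uniformly separated family of points are summable. -/
theorem summable_norm_sample (f : M1 E) {I : Type*} {p : I → E} {r : ℝ} (hr : 0 < r)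
    (hp : Pairwise fun i j => Disjoint (Metric.ball (p i) r) (Metric.ball (p j) r)) :
    Summable fun i => ‖f (p i)‖ := by
  set H : E → ℝ := fun x => ∫ w, ‖stft f (x, w)‖ with hH
  have hH0 : ∀ x, 0 ≤ H x := fun x => integral_nonneg fun w => norm_nonneg _
  have hHi : Integrable H := f.integrable_marginal
  -- `g` is the least value of `φ₀` on the closed ball of radius `r`. Integrating `pointwise_bound`
  -- over a ball around `p i` bounds `‖f (p i)‖ * (g * B)` by the mass of `H` there, and the balls
  -- are disjoint.
  set g : ℝ := (2 : ℝ) ^ ((Module.finrank ℝ E : ℝ) / 4) * Real.exp (-Real.pi * r ^ 2) with hg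
  set B : ℝ := volume.real (Metric.ball (0 : E) r) with hB
  have hBpos : 0 < B := by
    rw [hB, measureReal_def, ENNReal.toReal_pos_iff]
    exact ⟨Metric.measure_ball_pos volume _ hr, Metric.isBounded_ball.measure_lt_top⟩
  have hgpos : 0 < g := by positivity
  have hone : ∀ i, ‖f (p i)‖ * (g * B) ≤ ∫ x in Metric.ball (p i) r, H x := by
    intro i
    have h1 : ∫ x in Metric.ball (p i) r, ‖f (p i)‖ * g = ‖f (p i)‖ * (g * B) := by
      rw [setIntegral_const, smul_eq_mul, measureReal_def, Measure.addHaar_ball_center,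
        ← measureReal_def]
      ring
    rw [← h1]
    refine setIntegral_mono_ae_restrict
      (integrableOn_const Metric.isBounded_ball.measure_lt_top.ne) hHi.integrableOn ?_
    refine (ae_restrict_iff' measurableSet_ball).2 ?_
    filter_upwards [f.pointwise_bound] with x hx hxb
    refine le_trans (mul_le_mul_of_nonneg_left ?_ (norm_nonneg _)) (hx (p i))
    have h2 : ‖p i - x‖ ≤ r := by
      rw [← dist_eq_norm, dist_comm]
      exact (Metric.mem_ball.1 hxb).le
    rw [hg, gauss]
    refine mul_le_mul_of_nonneg_left (Real.exp_le_exp.mpr ?_) (by positivity)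
    have h3 : ‖p i - x‖ ^ 2 ≤ r ^ 2 := pow_le_pow_left₀ (norm_nonneg _) h2 2
    nlinarith [Real.pi_pos]
  have hs : Summable fun i => ‖f (p i)‖ * (g * B) := by
    refine summable_of_sum_le (c := ∫ x, H x) (fun i => by positivity) fun s => ?_
    calc _ ≤ ∑ i ∈ s, ∫ x in Metric.ball (p i) r, H x := Finset.sum_le_sum fun i _ => hone i
      _ = ∫ x in ⋃ i ∈ s, Metric.ball (p i) r, H x :=
          (integral_biUnion_finset s (fun i _ => measurableSet_ball)
            (fun i _ j _ hij => hp hij) fun i _ => hHi.integrableOn).symm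
      _ ≤ ∫ x, H x := setIntegral_le_integral hHi (ae_of_all _ hH0)
  have := hs.mul_right (g * B)⁻¹
  refine this.congr fun i => ?_
  field_simp

end SampleSummable

/-! ### The adjoint lattice and the sampling formula for traces. -/

section Lattice

variable {E : Type*} [NormedAddCommGroup E] [InnerProductSpace ℝ E] [FiniteDimensional ℝ E]
  [MeasurableSpace E] [BorelSpace E]

theorem symp_sub_right (a b c : Phase E) : symp a (b - c) = symp a b - symp a c := by
  rw [← inner_rot, ← inner_rot, ← inner_rot, inner_sub_right]

theorem abs_symp_le (a b : Phase E) : |symp a b| ≤ ‖a‖ * ‖b‖ := by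
  rw [← inner_rot]
  exact (abs_real_inner_le_norm _ _).trans (by rw [LinearIsometryEquiv.norm_map])

theorem e_eq_one_iff (θ : ℝ) : e θ = 1 ↔ ∃ n : ℤ, θ = n := by
  rw [e, Complex.exp_eq_one_iff]
  have h : (2 * Real.pi * Complex.I : ℂ) ≠ 0 := Complex.two_pi_I_ne_zero
  constructor
  · rintro ⟨n, hn⟩
    refine ⟨n, ?_⟩
    rw [mul_comm (n : ℂ)] at hn
    exact_mod_cast mul_left_cancel₀ h hn
  · rintro ⟨n, rfl⟩
    exact ⟨n, by push_cast; ring⟩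

theorem mem_adjointLattice_iff {Λ : Submodule ℤ (Phase E)} {z : Phase E} :
    z ∈ adjointLattice Λ ↔ ∀ l ∈ Λ, ∃ n : ℤ, symp l z = n := by
  refine forall₂_congr fun l _ => ?_
  rw [e_eq_one_iff, symp_swap z l]
  constructor
  · rintro ⟨n, hn⟩
    exact ⟨-n, by push_cast; linarith⟩
  · rintro ⟨n, hn⟩
    exact ⟨-n, by push_cast; linarith⟩

theorem sub_mem_adjointLattice {Λ : Submodule ℤ (Phase E)} {z w : Phase E}
    (hz : z ∈ adjointLattice Λ) (hw : w ∈ adjointLattice Λ) : z - w ∈ adjointLattice Λ := by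
  rw [mem_adjointLattice_iff] at *
  intro l hl
  obtain ⟨n, hn⟩ := hz l hl
  obtain ⟨m, hm⟩ := hw l hl
  exact ⟨n - m, by rw [symp_sub_right, hn, hm]; push_cast; ring⟩

theorem symp_eq_sum {ι : Type*} [Fintype ι] (b : Module.Basis ι ℝ (Phase E)) (v z : Phase E) :
    symp v z = ∑ i, symp (b i) z * b.repr v i := by
  conv_lhs => rw [← b.sum_repr v]
  rw [← inner_rot, map_sum, sum_inner]
  refine Finset.sum_congr rfl fun i _ => ?_
  rw [map_smul, real_inner_smul_left, inner_rot, mul_comm]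

/-- Nondegeneracy of the symplectic form: represent the functional with values `a i` on the basis by
Riesz and rotate. -/
theorem exists_symp_eq {ι : Type*} [Fintype ι] (b : Module.Basis ι ℝ (Phase E)) (a : ι → ℝ) :
    ∃ z, ∀ i, symp (b i) z = a i := by
  let ℓ : Phase E →L[ℝ] ℝ := LinearMap.toContinuousLinearMap (b.constr ℝ a)
  refine ⟨rot ((InnerProductSpace.toDual ℝ (Phase E)).symm ℓ), fun i => ?_⟩
  rw [symp_swap, ← inner_rot, rot_rot, inner_neg_left, neg_neg,
    InnerProductSpace.toDual_symm_apply]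
  exact b.constr_basis ℝ a i

/-- Membership in `Λ°` means integral symplectic pairing with a basis of `Λ`. The resulting
identification of `Λ°` with integer vectors matches points of `Λ°` with characters of the torus. -/
theorem exists_adjointLattice_coords {ι : Type*} [Fintype ι] (b : Module.Basis ι ℝ (Phase E))
    {Λ : Submodule ℤ (Phase E)} (hb : Submodule.span ℤ (Set.range b) = Λ) :
    ∃ N : adjointLattice Λ → ι → ℤ, Function.Bijective N ∧
      ∀ (z : adjointLattice Λ) i, symp (b i) z = N z i := by
  have hbΛ : ∀ i, b i ∈ Λ := fun i => hb ▸ Submodule.subset_span (Set.mem_range_self i)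
  have h : ∀ (z : adjointLattice Λ) i, ∃ n : ℤ, symp (b i) z = n := fun z i =>
    mem_adjointLattice_iff.1 z.2 (b i) (hbΛ i)
  choose N hN using h
  refine ⟨N, ⟨fun z w hzw => ?_, fun n => ?_⟩, hN⟩
  · have h1 : ∀ v, symp v (z.1 - w.1) = 0 := fun v => by
      rw [symp_eq_sum b]
      refine Finset.sum_eq_zero fun i _ => ?_
      rw [symp_sub_right, hN, hN, hzw, sub_self, zero_mul]
    have h2 := h1 (rot (z.1 - w.1))
    rw [← inner_rot, rot_rot, inner_neg_left, neg_eq_zero, inner_self_eq_zero, sub_eq_zero] at h2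
    exact Subtype.ext h2
  · obtain ⟨z, hz⟩ := exists_symp_eq b fun i => (n i : ℝ)
    have hmem : z ∈ adjointLattice Λ := by
      rw [mem_adjointLattice_iff]
      intro l hl
      rw [← hb, b.mem_span_iff_repr_mem ℤ] at hl
      choose k hk using hl
      refine ⟨∑ i, n i * k i, ?_⟩
      rw [symp_eq_sum b]
      push_cast
      refine Finset.sum_congr rfl fun i _ => ?_
      rw [hz, ← hk]
      simp
    refine ⟨⟨z, hmem⟩, funext fun i => ?_⟩
    have := hN ⟨z, hmem⟩ i
    rw [hz] at this
    exact_mod_cast this.symm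

theorem exists_adjointLattice_separation {ι : Type*} [Fintype ι] (b : Module.Basis ι ℝ (Phase E))
    {Λ : Submodule ℤ (Phase E)} (hb : Submodule.span ℤ (Set.range b) = Λ) :
    ∃ r : ℝ, 0 < r ∧ Pairwise fun i j : adjointLattice Λ =>
      Disjoint (Metric.ball (i : Phase E) r) (Metric.ball (j : Phase E) r) := by
  obtain ⟨N, hN, hNs⟩ := exists_adjointLattice_coords b hb
  -- Distinct points differ in some integer coordinate, so `1 ≤ |symp (b i) (z - w)| ≤ C * ‖z - w‖`,
  -- and `1 / (2 * C)` is half the resulting separation. The summand 1 keeps `C` positive for an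
  -- empty basis.
  set C : ℝ := ∑ i, ‖b i‖ + 1 with hC
  have hCpos : 0 < C := by positivity
  refine ⟨1 / (2 * C), by positivity, fun z w hzw => Metric.ball_disjoint_ball ?_⟩
  obtain ⟨i, hi⟩ := Function.ne_iff.1 fun h => hzw (hN.1 h)
  have h1 : (1 : ℝ) ≤ |symp (b i) (z.1 - w.1)| := by
    rw [symp_sub_right, hNs, hNs]
    have : (1 : ℤ) ≤ |N z i - N w i| := Int.one_le_abs (sub_ne_zero.2 hi)
    exact_mod_cast this
  have h2 : ‖b i‖ ≤ C := by
    have := Finset.single_le_sum (f := fun i => ‖b i‖) (fun j _ => norm_nonneg _)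
      (Finset.mem_univ i)
    rw [hC]; linarith
  have h3 : 1 ≤ C * dist z.1 w.1 := by
    rw [dist_eq_norm]
    exact (h1.trans (abs_symp_le _ _)).trans (mul_le_mul_of_nonneg_right h2 (norm_nonneg _))
  have h4 : 1 / (2 * C) + 1 / (2 * C) = 1 / C := by field_simp; norm_num
  rw [h4, div_le_iff₀ hCpos, mul_comm]
  exact h3

/-- In `⟨T π(l/2) f, π(l/2)^* g⟩` the atoms at `m + v/2` and `m - v/2` move in opposite directions
by `l/2`: the midpoint stays and the difference grows by `l`. The phase in `weylKern` absorbs the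
accumulated factors, leaving exact periodicity. -/
theorem weylKern_add {T : OpMInf E} {l : Phase E} (hl : opModulate l T = T) (m v : Phase E) :
    weylKern T (m, v + l) = weylKern T (m, v) := by
  have h1 : kern T (midpointHomeo (m, v)) =
      e (-inner ℝ m.snd l.fst) * kern T (midpointHomeo (m, v + l)) := by
    change T (atom (m + (1 / 2 : ℝ) • v)) (atom (m - (1 / 2 : ℝ) • v)) =
      _ * T (atom (m + (1 / 2 : ℝ) • (v + l))) (atom (m - (1 / 2 : ℝ) • (v + l)))
    conv_lhs => rw [← hl]
    change Complex.exp (-Real.pi * Complex.I * (inner ℝ l.fst l.snd : ℝ) / 2) *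
      T (tfShift ((1 / 2 : ℝ) • l) (atom (m + (1 / 2 : ℝ) • v)))
        (e (-inner ℝ ((1 / 2 : ℝ) • l).fst ((1 / 2 : ℝ) • l).snd) •
          tfShift (-((1 / 2 : ℝ) • l)) (atom (m - (1 / 2 : ℝ) • v))) = _
    have a1 : (1 / 2 : ℝ) • l + (m + (1 / 2 : ℝ) • v) = m + (1 / 2 : ℝ) • (v + l) := by module
    have a2 : -((1 / 2 : ℝ) • l) + (m - (1 / 2 : ℝ) • v) = m - (1 / 2 : ℝ) • (v + l) := by module
    have a3 : Complex.exp (-Real.pi * Complex.I * (inner ℝ l.fst l.snd : ℝ) / 2) =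
        e (-(inner ℝ l.fst l.snd / 4)) := by
      rw [e]
      congr 1
      push_cast
      ring
    rw [tfShift_atom, tfShift_atom, a1, a2, a3, T.map_smul, _root_.smul_apply,
      ContinuousLinearMap.map_smulₛₗ, ContinuousLinearMap.map_smulₛₗ, conj_e, conj_e]
    simp only [smul_eq_mul]
    simp only [← mul_assoc, ← e_add]
    congr 2
    simp only [snd_add, snd_sub, fst_neg, fst_smul, snd_smul,
      inner_add_left, inner_sub_left, inner_neg_right, real_inner_smul_left,
      real_inner_smul_right]
    ring
  rw [weylKern, weylKern, h1, ← mul_assoc, ← e_add]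
  dsimp only
  rw [fst_add, inner_add_right, neg_add]

/-- The trace of a modulation invariant operator against an operator with symbol `τ` samples `τ` on
the adjoint lattice. -/
theorem exists_sampling_coefficients (Λ : Submodule ℤ (Phase E)) [DiscreteTopology Λ]
    [IsZLattice ℝ Λ] (T : OpMInf E) (hT : IsModulationInvariant Λ T) :
    ∃ c : adjointLattice Λ → ℂ, ∀ τ : M1 (Phase E), HasSum (fun z => c z * τ z)
      (∫ p : Phase E × Phase E, symbolTransform τ p * weylKern T p) := by
  have : Module.Finite ℤ Λ := ZLattice.module_finite ℝ Λ
  have : Module.Free ℤ Λ := ZLattice.module_free ℝ Λ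
  let b := (Module.Free.chooseBasis ℤ Λ).ofZLatticeBasis ℝ Λ
  have hb : Submodule.span ℤ (Set.range b) = Λ := Module.Basis.ofZLatticeBasis_span ℝ _ _
  obtain ⟨N, hN, hNs⟩ := exists_adjointLattice_coords b hb
  obtain ⟨r, hr, hsep⟩ := exists_adjointLattice_separation b hb
  have hcount : Countable (adjointLattice Λ) := hN.1.countable
  obtain ⟨K, hK⟩ := exists_torus_lift b (continuous_weylKern T)
    fun m v l hl => weylKern_add (hT l (hb ▸ hl)) m v
  set C : ℝ := ‖T‖ * ‖(gaussM1 : M1 E)‖ * ‖(gaussM1 : M1 E)‖ with hC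
  have hKn : ∀ m, ‖K m‖ ≤ C := fun m => by
    rw [ContinuousMap.norm_le _ (by positivity)]
    intro x
    obtain ⟨v, rfl⟩ := (isOpenQuotientMap_toTorus b).surjective x
    rw [hK]
    exact norm_weylKern_le T _
  set ψ : Phase E → ℂ := fun u => ((gauss u * gauss u : ℝ) : ℂ) with hψ
  have hψi : Integrable ψ := M1.gauss_sq_integrable.ofReal
  -- The coefficient at `z` averages the Fourier coefficients in `v` of the periodic kernel of `T`
  -- over midpoints `m`, weighted by the window centred at `z`. It does not involve `τ`.
  refine ⟨fun z => ∫ m, ψ (z - m) * torusCoeff (N z) (K m), fun τ => ?_⟩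
  have hsum : Summable fun z : adjointLattice Λ => ‖τ z‖ := summable_norm_sample τ hr hsep
  have hterm : ∀ z : adjointLattice Λ,
      Integrable fun m => τ z * (ψ (z - m) * torusCoeff (N z) (K m)) := fun z =>
    ((hψi.comp_sub_left z.1).mul_bdd (c := C)
      ((torusCoeff (N z)).continuous.comp K.continuous).aestronglyMeasurable
      (ae_of_all _ fun m => (norm_torusCoeff_le _ _).trans (hKn m))).const_mul _
  have htn : ∀ z : adjointLattice Λ, ∫ m, ‖τ z * (ψ (z - m) * torusCoeff (N z) (K m))‖ ≤
      ‖τ z‖ * ((∫ u, ‖ψ u‖) * C) := fun z => by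
    rw [← integral_sub_left_eq_self (fun u => ‖ψ u‖) volume z.1, ← integral_mul_const,
      ← integral_const_mul]
    refine integral_mono (hterm z).norm
      (((hψi.comp_sub_left z.1).norm.mul_const C).const_mul _) fun m => ?_
    simp only [norm_mul]
    gcongr
    exact (norm_torusCoeff_le _ _).trans (hKn m)
  -- The sum over `Λ°` and the integral over `m` are interchanged; this rests on the summability of
  -- the samples of `τ`.
  have h := hasSum_integral_of_summable_integral_norm hterm
    ((hsum.mul_right _).of_nonneg_of_le (fun z => integral_nonneg fun m => norm_nonneg _) htn)
  simp only [integral_const_mul] at h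
  have hI := integrable_symbolTransform_mul τ T
  rw [Measure.volume_eq_prod] at hI ⊢
  rw [integral_prod _ hI]
  have hae : ∀ᵐ m : Phase E, ∫ v, symbolTransform τ (m, v) * weylKern T (m, v) =
      ∑' z : adjointLattice Λ, τ z * (ψ (z - m) * torusCoeff (N z) (K m)) := by
    filter_upwards [ae_integrable_symbolTransform τ] with m hm
    simp only [← hK, ← mul_assoc]
    refine integral_mul_periodic b hm hN ?_ (fun z => ?_) (K m)
    · refine (hsum.mul_right (gauss (0 : Phase E) * gauss (0 : Phase E))).of_nonneg_of_le
        (fun z => norm_nonneg _) fun z => ?_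
      rw [norm_mul]
      refine mul_le_mul_of_nonneg_left ?_ (norm_nonneg _)
      rw [hψ, Complex.norm_real, Real.norm_of_nonneg (mul_pos (gauss_pos _) (gauss_pos _)).le]
      exact mul_le_mul (gauss_le _) (gauss_le _) (gauss_pos _).le (gauss_pos _).le
    · have h1 := integral_symbolTransform_mul_e τ hm z.1
      have h2 : ∀ v, symp v z.1 = ∑ j, N z j * b.repr v j := fun v => by
        rw [symp_eq_sum b]
        simp only [hNs]
      simp only [h2] at h1
      exact h1
  rw [integral_congr_ae hae]
  simpa only [mul_comm] using h

theorem weylKern_smul (a : ℂ) (T : OpMInf E) (p : Phase E × Phase E) :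
    weylKern (a • T) p = a * weylKern T p :=
  mul_left_comm _ a _

theorem integral_symbolTransform_smul_shiftParity (τ : M1 (Phase E)) (a : ℂ) (u : Phase E) :
    ∫ p : Phase E × Phase E, symbolTransform τ p *
      weylKern ((a * ((2 : ℂ) ^ Module.finrank ℝ E * e (-(2 * inner ℝ u.fst u.snd)))) •
        shiftParity ((2 : ℝ) • u)) p = a * τ u := by
  rw [← integral_symbolTransform_shiftParity τ u]
  simp only [weylKern_smul, mul_left_comm (symbolTransform τ _)]
  rw [integral_const_mul, mul_assoc, mul_assoc]

end Lattice

end QHA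

end

/-! ### The sampled convolution formula. -/

theorem mainTheorem11 (d : ℕ)
    (Λ : Submodule ℤ (Phase (EuclideanSpace ℝ (Fin d)))) [DiscreteTopology Λ] [IsZLattice ℝ Λ]
    (K : Set (Phase (EuclideanSpace ℝ (Fin d)))) (hK : IsCompact K) (hK0 : K ∈ nhds 0)
    (hKΛ : K ∩ adjointLattice Λ = {0})
    (S : OpMInf (EuclideanSpace ℝ (Fin d))) (σ : M1 (Phase (EuclideanSpace ℝ (Fin d))))
    (hS : IsWeylSymbol S σ) (hσ0 : σ 0 ≠ 0) (hσK : tsupport σ ⊆ K)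
    (T : OpMInf (EuclideanSpace ℝ (Fin d))) (hT : IsModulationInvariant Λ T) :
    (∀ z, ∃! t : ℂ, IsTraceMul T (opTranslate z (opCheck S)) t) ∧
    WeakStarHasSum
      (fun l : adjointLattice Λ =>
        ((2 : ℂ) ^ d / σ 0 * opConv T S l *
          Complex.exp (-4 * Complex.I * Real.pi * (inner ℝ l.1.fst l.1.snd : ℝ))) •
            shiftParity ((2 : ℝ) • l.1)) T := by
  refine ⟨fun z => ?_, ?_⟩
  · have h := isTraceMul_iff (hS.opTranslate_opCheck z) T
    exact ⟨_, (h _).2 rfl, fun t ht => (h t).1 ht⟩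
  rintro R ⟨ρ, hρ⟩
  obtain ⟨c, hc⟩ := exists_sampling_coefficients Λ T hT
  have hconv : ∀ l : adjointLattice Λ, opConv T S l = c l * σ 0 := by
    intro l
    rw [opConv, traceMul_eq (hS.opTranslate_opCheck l) T]
    refine (hc _).unique ?_
    have h1 : c l * σ 0 = c l * reflectM1 l.1 σ l := by rw [reflectM1_apply, sub_self]
    rw [h1]
    -- A nonzero term at `m` forces `l - m` into `K ∩ Λ°`, hence `m = l`: the reflected symbol
    -- isolates a single coefficient.
    refine hasSum_single (f := fun i : adjointLattice Λ => c i * reflectM1 l.1 σ i) l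
      fun m hm => ?_
    rw [reflectM1_apply]
    by_contra hne
    have h2 : l.1 - m.1 ∈ K := hσK (subset_tsupport _ (right_ne_zero_of_mul hne))
    have h3 : l.1 - m.1 ∈ K ∩ adjointLattice Λ := ⟨h2, sub_mem_adjointLattice l.2 m.2⟩
    rw [hKΛ, Set.mem_singleton_iff, sub_eq_zero] at h3
    exact hm (Subtype.ext h3.symm)
  have hbr : ∀ U, bracket U R =
      ∫ p : Phase (EuclideanSpace ℝ (Fin d)) × Phase (EuclideanSpace ℝ (Fin d)),
        symbolTransform (conjM1 ρ) p * weylKern U p := fun U => traceMul_eq hρ.opAdjoint U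
  rw [hbr]
  -- The factor `σ 0` of the convolution cancels the normalisation, so each term is `c l` times the
  -- quantised point mass at `l`; pairing with `R` evaluates the symbol `conj ρ` of the adjoint of
  -- `R` at `l`.
  have hterm : ∀ l : adjointLattice Λ, bracket (((2 : ℂ) ^ d / σ 0 * opConv T S l *
      Complex.exp (-4 * Complex.I * Real.pi * (inner ℝ l.1.fst l.1.snd : ℝ))) •
        shiftParity ((2 : ℝ) • l.1)) R = c l * conjM1 ρ l := by
    intro l
    rw [hbr, ← integral_symbolTransform_smul_shiftParity (conjM1 ρ) (c l) l.1, hconv,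
      finrank_euclideanSpace_fin]
    congr 3
    have h1 : Complex.exp (-4 * Complex.I * Real.pi * (inner ℝ l.1.fst l.1.snd : ℝ)) =
        e (-(2 * inner ℝ l.1.fst l.1.snd)) := by
      rw [e]
      congr 1
      push_cast
      ring
    rw [h1]
    field_simp
  simp only [hterm]
  exact hc (conjM1 ρ)
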